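/- Let $t\ge 1$ and $N$ be integers. For $c=(c_{ijl})\in\mathbb C^{t\times(t+1)\times N}$ let $M=M_c$ be the $t\times(t+1)$ matrix of linear forms $M_{ij}=\sum_{l=1}^N c_{ijl}x_l$ and let $X\subset(\mathbb C^N,0)$ be the scheme defined by the maximal minors of $M$. Assume that $X$ is an isolated Cohen–Macaulay codimension $2$ singularity (ICMC2) of type $(t,t+1,t)$, i.e. $X$ has codimension $2$ and is smooth outside the origin (a smooth germ is allowed). Let $W$ be the closure in $\mathbb C^{t\times(t+1)}\times\mathbb P^{t-1}$ of the set of pairs $(B,[s])$ with $\operatorname{rk}B=t-1$ and $s^{T}B=0$ (the graph of the map sending a matrix of rank $t-1$ to its column span, a hyperplane of $\mathbb C^t$), and let the Tjurina transform $Y\subset\mathbb C^N\times\mathbb P^{t-1}$ of $X$ be the pullback of $W$ along $M:\mathbb C^N\to\mathbb C^{t\times(t+1)}$. Let $A(s)$ be the $(t+1)\times N$ matrix of linear forms in $s=(s_1,\dots,s_t)$ with entries $A_{jl}=\sum_{i=1}^t c_{ijl}s_i$. Then, for generic $c$ (that is, for all $c$ as above in a suitable nonempty Zariski open subset of the coefficient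 space): 1. If $N\ge 3$ or $t=1$, then $Y$ is smooth if and only if $N\ge 2t$. 2. If $t+1\le N<2t$, then the singular locus of $Y$ is, as a set, $\{0\}\times\Sigma$, where $\Sigma\subset\mathbb P^{t-1}$ is the zero set of the maximal minors of $A(s)$. It is a determinantal variety of type $(t+1,N,t+1)$, i.e. of the expected codimension $N-t$, and has dimension $2t-N-1$. Moreover $A(s)$ is a generic matrix of linear forms: every property that holds for generic $(t+1)\times N$ matrices of linear forms in $t$ variables holds for $A(s)$ if $c$ is generic. -/

import Mathlib

noncomputable section

namespace TjurinaTransform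

open scoped LinearAlgebra.Projectivization

/-- A property of points of the complex affine space `ℂ^ι` holds for the generic point if it holds
on a nonempty Zariski open subset, i.e. off the zero set of some nonzero polynomial. -/
def Generic {ι : Type*} (P : (ι → ℂ) → Prop) : Prop :=
  ∃ G : MvPolynomial ι ℂ, G ≠ 0 ∧ ∀ c : ι → ℂ, MvPolynomial.eval c G ≠ 0 → P c

/-- Coefficients of an `m × n` matrix of linear forms in `k` variables:
`c (i, j, l)` is the coefficient of the `l`-th variable in the `(i, j)`-entry. -/
abbrev LinCoeff (m n k : ℕ) : Type := Fin m × Fin n × Fin k → ℂ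

/-- The `m × n` matrix of linear forms in `k` variables with the given coefficients. -/
def linMatrix {m n k : ℕ} (c : LinCoeff m n k) :
    Matrix (Fin m) (Fin n) (MvPolynomial (Fin k) ℂ) :=
  Matrix.of fun i j => ∑ l : Fin k, MvPolynomial.C (c (i, j, l)) * MvPolynomial.X l

/-- The ideal generated by the `r`-minors of a matrix. (Non-injective choices of rows or columns
contribute `0`, and reorderings only change a sign.) -/
def minorsIdeal {R : Type*} [CommRing R] {m n : ℕ} (F : Matrix (Fin m) (Fin n) R) (r : ℕ) :
    Ideal R :=
  Ideal.span {d | ∃ (f : Fin r → Fin m) (g : Fin r → Fin n), d = (F.submatrix f g).det}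

/-- The polynomial matrix `F`, seen as a map from affine space to the `m × n` matrices, defines
a determinantal variety of type `(m, n, r)`: the preimage of the matrices of rank `< r`
has the expected codimension `(m - r + 1)(n - r + 1)`. For a matrix of linear forms the variety is
a cone, and its codimension is also that of the corresponding projective variety
when the latter is nonempty. -/
def IsDeterminantal {m n k : ℕ} (F : Matrix (Fin m) (Fin n) (MvPolynomial (Fin k) ℂ))
    (r : ℕ) : Prop :=
  1 ≤ r ∧ r ≤ m ∧ r ≤ n ∧
    (minorsIdeal F r).height = (((m - r + 1) * (n - r + 1) : ℕ) : ℕ∞)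

/-- The local ring of `V(I)` at the point `x` is smooth over `ℂ`
(the prime `q` is the maximal ideal of the point `x`). -/
def IsSmoothPoint {σ : Type*} (I : Ideal (MvPolynomial σ ℂ)) (x : σ → ℂ) : Prop :=
  ∃ q ∈ Algebra.smoothLocus ℂ (MvPolynomial σ ℂ ⧸ I),
    q.asIdeal.comap (Ideal.Quotient.mk I) = MvPolynomial.vanishingIdeal ℂ {x}

/-- The singular points of the affine scheme `V(I)`. -/
def singularPoints {σ : Type*} (I : Ideal (MvPolynomial σ ℂ)) : Set (σ → ℂ) :=
  {x | x ∈ MvPolynomial.zeroLocus ℂ I ∧ ¬ IsSmoothPoint I x}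

/-- The maximal minors of the `t × (t + 1)` matrix of linear forms with coefficients `c` define an
isolated Cohen-Macaulay codimension 2 singularity `X` in `(ℂ^N, 0)`: `X` is a determinantal
variety of type `(t, t + 1, t)`, that is, has codimension 2 (the local ring is then
Cohen-Macaulay by the Hilbert-Burch / Eagon-Hochster theorem), and it has no
singular point other than, possibly, the origin. Since `X` is a cone, the condition on `X` and the
condition on its germ at the origin are the same. -/
def IsICMC2 {t N : ℕ} (c : LinCoeff t (t + 1) N) : Prop :=
  IsDeterminantal (linMatrix c) t ∧
    ∀ x ∈ singularPoints (minorsIdeal (linMatrix c) t), x = 0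

/-- The graph of the rational map sending an `m × n` matrix of rank `m - 1` to its column
span, a hyperplane of `ℂ^m`, in the chart `s i = 1` of the projective space of hyperplanes:
the hyperplane `∑ a, s a * v a = 0` has homogeneous coordinates `s`. -/
def graphChart (m n : ℕ) (i : Fin m) : Set ((Fin m × Fin n) ⊕ Fin m → ℂ) :=
  {z | (Matrix.of fun a b => z (Sum.inl (a, b)) : Matrix (Fin m) (Fin n) ℂ).rank + 1 = m ∧
    z (Sum.inr i) = 1 ∧ ∀ b, ∑ a, z (Sum.inr a) * z (Sum.inl (a, b)) = 0}

/-- The ideal, in the chart `s i = 1` of `ℂ^k × ℙ^(m-1)`, of the Tjurina transform of the variety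
defined by the maximal minors of the `m × n` matrix `F` (`m ≤ n`): the transform is the
scheme-theoretic pullback, along `F`, of the closure `W` of the graph of the column span map, and
pulling back replaces the matrix coordinates by the entries of `F` in the equations of `W`. -/
def tjurinaIdeal {m n k : ℕ} (F : Matrix (Fin m) (Fin n) (MvPolynomial (Fin k) ℂ)) (i : Fin m) :
    Ideal (MvPolynomial (Fin k ⊕ Fin m) ℂ) :=
  (MvPolynomial.vanishingIdeal ℂ (graphChart m n i)).map
    (MvPolynomial.aeval (Sum.elim
      (fun p : Fin m × Fin n => MvPolynomial.rename Sum.inl (F p.1 p.2))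
      (fun a : Fin m => MvPolynomial.X (Sum.inr a))) :
        MvPolynomial ((Fin m × Fin n) ⊕ Fin m) ℂ →ₐ[ℂ] MvPolynomial (Fin k ⊕ Fin m) ℂ)

/-- The coordinates, in the chart `s i = 1`, of a point of `ℂ^k × ℙ^(m-1)`. -/
def chartPoint {m k : ℕ} (i : Fin m) (y : (Fin k → ℂ) × ℙ ℂ (Fin m → ℂ)) :
    Fin k ⊕ Fin m → ℂ :=
  Sum.elim y.1 ((y.2.rep i)⁻¹ • y.2.rep)

/-- The singular locus of the Tjurina transform, as a subset of `ℂ^k × ℙ^(m-1)`. -/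
def tjurinaSing {m n k : ℕ} (F : Matrix (Fin m) (Fin n) (MvPolynomial (Fin k) ℂ)) :
    Set ((Fin k → ℂ) × ℙ ℂ (Fin m → ℂ)) :=
  {y | ∃ i, y.2.rep i ≠ 0 ∧ chartPoint i y ∈ singularPoints (tjurinaIdeal F i)}

/-- The Tjurina transform is smooth: it has no singular point. -/
def TjurinaSmooth {m n k : ℕ} (F : Matrix (Fin m) (Fin n) (MvPolynomial (Fin k) ℂ)) : Prop :=
  tjurinaSing F = ∅

/-- The coefficients of the `(t + 1) × N` matrix `A` of linear forms in `s` whose `(j, l)`-entry is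
`∑ i, c (i, j, l) * s i`, that is, the derivative by `x l` of the bilinear form
`∑ i, s i * M i j` if `M` is the matrix of linear forms in `x` with coefficients `c`. -/
def derivCoeff {t N : ℕ} (c : LinCoeff t (t + 1) N) : LinCoeff (t + 1) N t :=
  fun p => c (p.2.2, p.1, p.2.1)

/-- The zero set in projective space of a homogeneous ideal. -/
def projZeros {t : ℕ} (I : Ideal (MvPolynomial (Fin t) ℂ)) : Set (ℙ ℂ (Fin t → ℂ)) :=
  {p | ∀ f ∈ I, MvPolynomial.eval p.rep f = 0}

/-- A subset `Z` of `ℙ^(t-1)` has dimension `d` in the Zariski topology: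
the affine cone over `Z` has dimension `d + 1`. -/
def HasProjDim {t : ℕ} (Z : Set (ℙ ℂ (Fin t → ℂ))) (d : ℕ) : Prop :=
  ringKrullDim (MvPolynomial (Fin t) ℂ ⧸
      MvPolynomial.vanishingIdeal ℂ {v : Fin t → ℂ | ∃ p ∈ Z, v ∈ p.submodule}) =
    ((d + 1 : ℕ) : WithBot ℕ∞)

end TjurinaTransform

end

/-!
In the chart `s i = 1` the Tjurina transform is cut out by `s i - 1` and the bilinear equations
`sᵀ M(x) = 0`. At `(x, s)` the Jacobian matrix of the latter has the rows of `A(s)` for the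
derivatives by `x` and those of `M(x)ᵀ` for the derivatives by `s`.

* Over a point `x ≠ 0`, a linear relation between the rows of the Jacobian matrix would make the
  gradients at `x` of all maximal minors of `M` proportional to one vector, and then `X`, smooth at
  `x`, would have codimension at most `1` there. Hence the transform is smooth over `x ≠ 0`.
* Over `x = 0` the Jacobian matrix is `A(s)`, and the transform is smooth at `(0, s)` if and only
  if `A(s)` has its generic rank.

A system of bilinear forms with too few equations always has a nontrivial solution, by
semicontinuity from a system solvable by the implicit function theorem. With enough equations the
generic system has none: by elimination this is an open condition, and it holds for the system
which expresses the multiplication of polynomials. So `A(s)` drops rank somewhere if and only if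
`N < 2 * t`.
The degeneracy locus meets the generic linear space of complementary dimension only at `0` and all
larger ones nontrivially, which determines its codimension by way of a homogeneous system of
parameters.
-/

noncomputable section

namespace TjurinaTransform

open MvPolynomial

open scoped LinearAlgebra.Projectivization Matrix

section JacobianCriterion

open TensorProduct KaehlerDifferential

section Algebra

variable {R A : Type*} [CommRing R] [CommRing A] [Algebra R A]

lemma one_tmul_eq_zero_iff {k M : Type*} [CommRing k] [Algebra A k] [AddCommGroup M] [Module A M]
    (hk : Function.Surjective (algebraMap A k)) (x : M) :
    (1 : k) ⊗ₜ[A] x = 0 ↔ x ∈ (RingHom.ker (algebraMap A k) • ⊤ : Submodule A M) := by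
  let e : (A ⧸ RingHom.ker (algebraMap A k)) ≃ₗ[A] k :=
    (Algebra.linearMap A k).quotKerEquivOfSurjective hk
  have he : e.symm 1 = Ideal.Quotient.mk _ 1 := by
    rw [LinearEquiv.symm_apply_eq]
    exact (map_one (algebraMap A k)).symm
  let E := (TensorProduct.congr e (.refl A M)).symm ≪≫ₗ
    quotTensorEquivQuotSMul M (RingHom.ker (algebraMap A k))
  have hE : E (1 ⊗ₜ x) = Submodule.Quotient.mk x := by
    simp only [E, LinearEquiv.trans_apply, congr_symm_tmul, he, LinearEquiv.refl_symm,
      LinearEquiv.refl_apply, quotTensorEquivQuotSMul_mk_tmul, one_smul]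
  rw [← E.map_eq_zero_iff, hE, Submodule.Quotient.mk_eq_zero]

lemma injective_cotangentComplexBaseChange_iff (M : Submonoid A) {P S k : Type*} [CommRing P]
    [CommRing S] [CommRing k] [Algebra A P] [Algebra R P] [Algebra P S] [Algebra A k] [Algebra P k]
    [Algebra S k] [IsScalarTower R A P] [IsScalarTower A P k] [IsScalarTower P S k]
    [IsLocalization M P] (hk : Function.Surjective (algebraMap A k)) {I : Ideal A}
    (hI : RingHom.ker (algebraMap P S) = I.map (algebraMap A P)) :
    Function.Injective (cotangentComplexBaseChange R S P k) ↔
      ∀ f ∈ I, (1 : k) ⊗ₜ[A] D R A f = 0 → f ∈ RingHom.ker (algebraMap A k) * I := by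
  have : Algebra.FormallyEtale A P := .of_isLocalization M
  let eI : k ⊗[A] I ≃ₗ[k] k ⊗[P] RingHom.ker (algebraMap P S) :=
    (AlgebraTensorModule.cancelBaseChange A P k k I).symm ≪≫ₗ
      AlgebraTensorModule.congr (.refl k k)
        ((IsLocalizedModule.isBaseChange M P (Algebra.idealMap P I)).equiv ≪≫ₗ .ofEq _ _ hI.symm)
  let eΩ : k ⊗[P] Ω[P⁄R] ≃ₗ[k] k ⊗[A] Ω[A⁄R] :=
    AlgebraTensorModule.congr (.refl k k) (tensorKaehlerEquivOfFormallyEtale R A P).symm ≪≫ₗ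
      AlgebraTensorModule.cancelBaseChange A P k k Ω[A⁄R]
  have hmap : ∀ f : I, eΩ (cotangentComplexBaseChange R S P k (eI (1 ⊗ₜ f))) =
      1 ⊗ₜ[A] D R A (f : A) := by
    intro f
    simp [eI, eΩ, IsBaseChange.equiv_tmul, cotangentComplexBaseChange_tmul,
      tensorKaehlerEquivOfFormallyEtale_symm_D_algebraMap]
  have hmem : ∀ f : I, (1 : k) ⊗ₜ[A] f = 0 ↔ (f : A) ∈ RingHom.ker (algebraMap A k) * I := by
    intro f
    rw [one_tmul_eq_zero_iff hk, ← smul_eq_mul, Submodule.mem_smul_top_iff]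
  rw [injective_iff_map_eq_zero]
  constructor
  · intro H f hf h0
    rw [← hmem ⟨f, hf⟩, ← eI.map_eq_zero_iff]
    exact H _ (eΩ.map_eq_zero_iff.1 ((hmap ⟨f, hf⟩).trans h0))
  · intro H z hz
    obtain ⟨z, rfl⟩ := eI.surjective z
    obtain ⟨f, rfl⟩ := TensorProduct.mk_surjective A I k hk z
    rw [TensorProduct.mk_apply] at hz ⊢
    rw [eI.map_eq_zero_iff, hmem]
    exact H f f.2 (by rw [← hmap, hz, map_zero])

theorem isSmoothAt_quotient_iff [Algebra.FormallySmooth R A] [Module.Free A Ω[A⁄R]]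
    [Module.Finite A Ω[A⁄R]] {I : Ideal A} (hI : I.FG) (q : Ideal (A ⧸ I)) [q.IsMaximal] :
    Algebra.IsSmoothAt R q ↔
      ∀ f ∈ I, (1 : q.ResidueField) ⊗ₜ[A] D R A f = 0 → f ∈ q.under A * I := by
  let P := Localization.AtPrime (q.under A)
  let S := Localization.AtPrime q
  let : Algebra P S := Localization.AtPrime.algebraOfLiesOver (q.under A) q
  have : IsScalarTower R P S := inferInstance
  have : IsScalarTower A S q.ResidueField := .of_algebraMap_eq fun _ => rfl
  have : IsScalarTower A P q.ResidueField := .to₁₂₄ A P S _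
  have : Algebra.FormallyEtale A P := .of_isLocalization (q.under A).primeCompl
  have : Algebra.FormallySmooth R P := .comp R A P
  let eΩ : P ⊗[A] Ω[A⁄R] ≃ₗ[P] Ω[P⁄R] := tensorKaehlerEquivOfFormallyEtale R A P
  have : Module.Free P Ω[P⁄R] := .of_equiv eΩ
  have : Module.Finite P Ω[P⁄R] := .equiv eΩ
  have hM : (q.under A).primeCompl.map (Ideal.Quotient.mk I) = q.primeCompl := by
    ext b
    obtain ⟨a, rfl⟩ := Ideal.Quotient.mk_surjective b
    constructor
    · rintro ⟨c, hc, h⟩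
      exact h ▸ hc
    · exact fun h => ⟨a, h, rfl⟩
  have hker : RingHom.ker (algebraMap P S) = I.map (algebraMap A P) := by
    refine (IsLocalization.ker_map S (Ideal.Quotient.mk I) hM).trans ?_
    rw [Ideal.mk_ker]
  have hsurj : Function.Surjective (algebraMap P S) :=
    RingHom.surjective_localRingHom_of_surjective _ Ideal.Quotient.mk_surjective q
  have hk : Function.Surjective (algebraMap A q.ResidueField) :=
    q.algebraMap_residueField_surjective.comp Ideal.Quotient.mk_surjective
  have hkerk : RingHom.ker (algebraMap A q.ResidueField) = q.under A := by
    ext a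
    exact Ideal.algebraMap_residueField_eq_zero
  rw [Algebra.IsSmoothAt,
    Algebra.FormallySmooth.iff_injective_cotangentComplexBaseChange_residueField P hsurj
      (hker ▸ hI.map _),
    injective_cotangentComplexBaseChange_iff (q.under A).primeCompl hk hker, hkerk]

end Algebra

section Gradient

variable {K σ : Type*} [CommRing K]

/-- The gradient of a polynomial at a point, as a linear function of the polynomial. -/
def grad (y : σ → K) : MvPolynomial σ K →ₗ[K] (σ → K) :=
  LinearMap.pi fun i => (aeval y).toLinearMap ∘ₗ (pderiv i).toLinearMap

@[simp]
lemma grad_apply (y : σ → K) (f : MvPolynomial σ K) (i : σ) :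
    grad y f i = eval y (pderiv i f) := by
  simp [grad, aeval_eq_eval]

lemma grad_mul (y : σ → K) (f g : MvPolynomial σ K) :
    grad y (f * g) = eval y f • grad y g + eval y g • grad y f := by
  ext i
  simp [Derivation.leibniz]

lemma grad_mem_span_of_mem_span {y : σ → K} {G : Set (MvPolynomial σ K)}
    (hG : ∀ g ∈ G, eval y g = 0) {f : MvPolynomial σ K} (hf : f ∈ Ideal.span G) :
    grad y f ∈ Submodule.span K (grad y '' G) := by
  have hle : Ideal.span G ≤ RingHom.ker (eval y) := Ideal.span_le.2 hG
  induction hf using Submodule.span_induction with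
  | mem x hx => exact Submodule.subset_span ⟨x, hx, rfl⟩
  | zero => simp
  | add x z _ _ hx hz => rw [map_add]; exact add_mem hx hz
  | smul a x hx hx' =>
    have h0 : eval y x = 0 := hle hx
    rw [smul_eq_mul, grad_mul, h0, zero_smul, add_zero]
    exact Submodule.smul_mem _ _ hx'

end Gradient

section Field

variable {K σ : Type*} [Field K] {I : Ideal (MvPolynomial σ K)} {y : σ → K}

lemma le_vanishingIdeal_singleton_iff : I ≤ vanishingIdeal K {y} ↔ y ∈ zeroLocus K I := by
  simp only [SetLike.le_def, mem_vanishingIdeal_singleton_iff, mem_zeroLocus_iff]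

lemma one_tmul_D_eq_zero_iff_grad_eq_zero {k : Type*} [Field k] [Algebra (MvPolynomial σ K) k]
    (hk : RingHom.ker (algebraMap (MvPolynomial σ K) k) = vanishingIdeal K {y})
    (f : MvPolynomial σ K) : (1 : k) ⊗ₜ[MvPolynomial σ K] D K (MvPolynomial σ K) f = 0 ↔
      grad y f = 0 := by
  have hzero (g : MvPolynomial σ K) : algebraMap _ k g = 0 ↔ eval y g = 0 := by
    rw [← RingHom.mem_ker, hk, mem_vanishingIdeal_singleton_iff]
    simp
  rw [← ((mvPolynomialBasis K σ).baseChange k).repr.map_eq_zero_iff, Finsupp.ext_iff, funext_iff]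
  refine forall_congr' fun i => ?_
  rw [Module.Basis.baseChange_repr_tmul, mvPolynomialBasis_repr_apply, Algebra.smul_def, mul_one,
    Finsupp.zero_apply, hzero, grad_apply, Pi.zero_apply]

lemma isSmoothAt_iff_grad [Finite σ] (q : Ideal (MvPolynomial σ K ⧸ I)) [q.IsMaximal]
    (hq : q.comap (Ideal.Quotient.mk I) = vanishingIdeal K {y}) :
    Algebra.IsSmoothAt K q ↔ ∀ f ∈ I, grad y f = 0 → f ∈ vanishingIdeal K {y} * I := by
  have hk : RingHom.ker (algebraMap (MvPolynomial σ K) q.ResidueField) = vanishingIdeal K {y} := by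
    rw [← hq]
    ext f
    exact Ideal.algebraMap_residueField_eq_zero
  have hfin : Module.Finite (MvPolynomial σ K) Ω[MvPolynomial σ K⁄K] :=
    .of_basis (mvPolynomialBasis K σ)
  have hfree : Module.Free (MvPolynomial σ K) Ω[MvPolynomial σ K⁄K] :=
    .of_basis (mvPolynomialBasis K σ)
  rw [isSmoothAt_quotient_iff (IsNoetherian.noetherian I) q]
  simp only [one_tmul_D_eq_zero_iff_grad_eq_zero hk, ← hq, Ideal.under_def,
    Ideal.Quotient.algebraMap_eq]

end Field

section Complex

variable {σ : Type*} [Finite σ] {I : Ideal (MvPolynomial σ ℂ)} {y : σ → ℂ}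

/- No localization at `y` appears because `I / 𝔪 I` is a module over `ℂ[σ] / 𝔪 = ℂ`, so it is
already local. -/
theorem isSmoothPoint_iff_grad (hy : y ∈ zeroLocus ℂ I) :
    IsSmoothPoint I y ↔ ∀ f ∈ I, grad y f = 0 → f ∈ vanishingIdeal ℂ {y} * I := by
  have hle := le_vanishingIdeal_singleton_iff.2 hy
  have hmax : ((vanishingIdeal ℂ {y}).map (Ideal.Quotient.mk I)).IsMaximal :=
    .map_of_surjective_of_ker_le Ideal.Quotient.mk_surjective (by rwa [Ideal.mk_ker])
  constructor
  · rintro ⟨q, hq, hqy⟩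
    have : q.asIdeal.IsMaximal := by
      rwa [← Ideal.map_comap_of_surjective _ Ideal.Quotient.mk_surjective q.asIdeal, hqy]
    exact (isSmoothAt_iff_grad q.asIdeal hqy).1 hq
  · intro h
    have hqy := Ideal.comap_map_mk hle
    exact ⟨⟨_, hmax.isPrime⟩, (isSmoothAt_iff_grad _ hqy).2 h, hqy⟩

theorem isSmoothPoint_of_linearIndependent {κ : Type*} [Finite κ]
    (f : κ → MvPolynomial σ ℂ) (hy : ∀ k, eval y (f k) = 0)
    (hf : LinearIndependent ℂ fun k => grad y (f k)) :
    IsSmoothPoint (Ideal.span (Set.range f)) y := by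
  rw [isSmoothPoint_iff_grad (by rw [zeroLocus_span]; rintro _ ⟨k, rfl⟩; exact hy k)]
  have := Fintype.ofFinite κ
  intro g hg h0
  obtain ⟨a, rfl⟩ := Ideal.mem_span_range_iff_exists_fun.1 hg
  have hsum : ∑ k, eval y (a k) • grad y (f k) = 0 := by
    simpa only [map_sum, grad_mul, hy, zero_smul, add_zero] using h0
  refine Ideal.sum_mem _ fun k _ => Ideal.mul_mem_mul ?_ (Ideal.subset_span ⟨k, rfl⟩)
  exact (mem_vanishingIdeal_singleton_iff y _).2 (Fintype.linearIndependent_iff.1 hf _ hsum k)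

theorem IsSmoothPoint.exists_mul_mem_span (hy : y ∈ zeroLocus ℂ I)
    (h : IsSmoothPoint I y) {F : Set (MvPolynomial σ ℂ)} (hF : F ⊆ I)
    (hd : ∀ f ∈ I, grad y f ∈ Submodule.span ℂ (grad y '' F)) :
    ∃ r, eval y r ≠ 0 ∧ ∀ f ∈ I, r * f ∈ Ideal.span F := by
  rw [isSmoothPoint_iff_grad hy] at h
  have hle : I ≤ Ideal.span F ⊔ vanishingIdeal ℂ {y} • I := by
    intro f hf
    obtain ⟨g, hg, hfg⟩ : grad y f ∈ (Submodule.span ℂ F).map (grad y) := by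
      rw [Submodule.map_span]
      exact hd f hf
    have hgF : g ∈ Ideal.span F := Submodule.span_le_restrictScalars ℂ (MvPolynomial σ ℂ) F hg
    have hfg' := h (f - g) (I.sub_mem hf (Ideal.span_le.2 hF hgF)) (by rw [map_sub, hfg, sub_self])
    rw [← add_sub_cancel g f]
    exact Submodule.add_mem_sup hgF hfg'
  obtain ⟨r, hr, hrI⟩ := Submodule.exists_sub_one_mem_and_smul_le_of_fg_of_le_sup
    (IsNoetherian.noetherian I) le_rfl hle
  refine ⟨r, fun h0 => ?_, fun f hf => hrI ⟨f, hf, rfl⟩⟩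
  simp [aeval_eq_eval, h0] at hr

theorem IsSmoothPoint.height_le_one (hy : y ∈ zeroLocus ℂ I)
    (h : IsSmoothPoint I y) {f₀ : MvPolynomial σ ℂ} (hf₀ : f₀ ∈ I)
    (hd : ∀ f ∈ I, grad y f ∈ Submodule.span ℂ {grad y f₀}) : I.height ≤ 1 := by
  obtain ⟨r, hr, hrI⟩ := h.exists_mul_mem_span hy (Set.singleton_subset_iff.2 hf₀)
    (by simpa only [Set.image_singleton] using hd)
  obtain ⟨p, hp, hpm⟩ := Ideal.exists_minimalPrimes_le
    ((Ideal.span_singleton_le_iff_mem _).2 (le_vanishingIdeal_singleton_iff.2 hy hf₀))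
  have := hp.1.1
  have hrp : r ∉ p := fun h => hr ((mem_vanishingIdeal_singleton_iff y r).1 (hpm h))
  have hIp : I ≤ p := fun f hf => (this.mem_or_mem (hp.1.2 (hrI f hf))).resolve_left hrp
  exact (Ideal.height_mono hIp).trans
    (Ideal.height_le_one_of_isPrincipal_of_mem_minimalPrimes _ p hp)

end Complex

end JacobianCriterion

section MatrixRank

variable {K m n : Type*} [Field K] [Fintype n]

lemma le_rank_of_submatrix_det_ne_zero (A : Matrix m n K) {r : ℕ} (f : Fin r → m) (g : Fin r → n)
    (h : (A.submatrix f g).det ≠ 0) : r ≤ A.rank := by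
  have hrank := Matrix.rank_of_det_ne_zero h
  rw [Fintype.card_fin] at hrank
  exact hrank ▸ Matrix.rank_submatrix_le A f g

lemma exists_rows_linearIndependent [Finite m] (A : Matrix m n K) {r : ℕ} (hr : A.rank = r) :
    ∃ f : Fin r → m, LinearIndependent K (A.submatrix f id).row ∧
      Submodule.span K (Set.range (A.submatrix f id).row) =
        Submodule.span K (Set.range A.row) := by
  obtain ⟨κ, a, ha, hspan, hli⟩ := exists_linearIndependent' K A.row
  have : Finite κ := Finite.of_injective a ha
  have := Fintype.ofFinite κ
  have hcard : Fintype.card κ = r := by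
    rw [← hr, Matrix.rank_eq_finrank_span_row, ← hspan, finrank_span_eq_card hli]
  let e := Fintype.equivFinOfCardEq hcard
  refine ⟨a ∘ e.symm, hli.comp _ e.symm.injective, ?_⟩
  rw [← hspan]
  congr 1
  exact e.symm.surjective.range_comp (A.row ∘ a)

lemma exists_submatrix_det_ne_zero [Finite m] (A : Matrix m n K) {r : ℕ} (hr : A.rank = r) :
    ∃ (f : Fin r → m) (g : Fin r → n), (A.submatrix f g).det ≠ 0 := by
  obtain ⟨f, hf, -⟩ := exists_rows_linearIndependent A hr
  have hrank : (A.submatrix f id)ᵀ.rank = r := by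
    simpa only [Matrix.rank_transpose, Fintype.card_fin] using hf.rank_matrix
  obtain ⟨g, hg, -⟩ := exists_rows_linearIndependent (A.submatrix f id)ᵀ hrank
  refine ⟨f, g, ?_⟩
  rw [← Matrix.det_transpose, ← isUnit_iff_ne_zero, ← Matrix.isUnit_iff_isUnit_det,
    ← Matrix.linearIndependent_rows_iff_isUnit]
  exact hg

lemma rank_eq_card_iff_vecMul [Fintype m] (A : Matrix m n K) :
    A.rank = Fintype.card m ↔ ∀ v, v ᵥ* A = 0 → v = 0 := by
  rw [Matrix.rank_eq_finrank_span_row, ← Set.finrank, eq_comm,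
    ← linearIndependent_iff_card_eq_finrank_span, ← Matrix.vecMul_injective_iff]
  exact injective_iff_map_eq_zero A.vecMulLinear

lemma rank_lt_card_iff_exists_vecMul [Fintype m] (A : Matrix m n K) :
    A.rank < Fintype.card m ↔ ∃ v ≠ 0, v ᵥ* A = 0 := by
  rw [A.rank_le_card_height.lt_iff_ne, Ne, rank_eq_card_iff_vecMul]
  simp only [not_forall, exists_prop, and_comm, ne_eq]

lemma submatrix_det_eq_zero_iff_exists_vecMul {m : ℕ} {n : Type*} [Finite n]
    (A : Matrix (Fin m) n K) :
    (∀ (f : Fin m → Fin m) (g : Fin m → n), (A.submatrix f g).det = 0) ↔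
      ∃ v ≠ 0, v ᵥ* A = 0 := by
  have := Fintype.ofFinite n
  rw [← rank_lt_card_iff_exists_vecMul, Fintype.card_fin]
  constructor
  · intro h
    refine (A.rank_le_card_height.trans_eq (Fintype.card_fin m)).lt_of_ne fun hr => ?_
    obtain ⟨f, g, hfg⟩ := exists_submatrix_det_ne_zero A hr
    exact hfg (h f g)
  · intro h f g
    by_contra hfg
    exact h.not_ge (le_rank_of_submatrix_det_ne_zero A f g hfg)

lemma mem_zeroLocus_minorsIdeal {σ : Type*} {m n : ℕ}
    {F : Matrix (Fin m) (Fin n) (MvPolynomial σ K)} {z : σ → K} :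
    z ∈ zeroLocus K (minorsIdeal F m) ↔ ∃ v ≠ 0, v ᵥ* F.map (eval z) = 0 := by
  rw [← submatrix_det_eq_zero_iff_exists_vecMul, minorsIdeal, zeroLocus_span]
  simp only [Set.mem_ofPred_eq, forall_exists_index, aeval_eq_eval]
  constructor
  · intro h f g
    rw [Matrix.submatrix_map, ← RingHom.mapMatrix_apply, ← RingHom.map_det]
    exact h _ f g rfl
  · rintro h _ f g rfl
    rw [RingHom.map_det, RingHom.mapMatrix_apply, ← Matrix.submatrix_map]
    exact h f g

end MatrixRank

section LinearForms

variable {m n k : ℕ}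

/-- The value at the point `x` of the matrix of linear forms with coefficients `c`. -/
def evalMatrix (c : LinCoeff m n k) (x : Fin k → ℂ) : Matrix (Fin m) (Fin n) ℂ :=
  Matrix.of fun i j => ∑ l, c (i, j, l) * x l

lemma eval_linMatrix (c : LinCoeff m n k) (x : Fin k → ℂ) (i : Fin m) (j : Fin n) :
    eval x (linMatrix c i j) = evalMatrix c x i j := by
  simp [linMatrix, evalMatrix]

lemma map_eval_linMatrix (c : LinCoeff m n k) (x : Fin k → ℂ) :
    (linMatrix c).map (eval x) = evalMatrix c x :=
  Matrix.ext (eval_linMatrix c x)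

lemma evalMatrix_zero (c : LinCoeff m n k) : evalMatrix c 0 = 0 := by
  ext
  simp [evalMatrix]

lemma evalMatrix_smul (c : LinCoeff m n k) (τ : ℂ) (x : Fin k → ℂ) :
    evalMatrix c (τ • x) = τ • evalMatrix c x := by
  ext i j
  simp [evalMatrix, Finset.mul_sum, mul_left_comm]

lemma rank_evalMatrix_smul (c : LinCoeff m n k) {τ : ℂ} (hτ : τ ≠ 0) (x : Fin k → ℂ) :
    (evalMatrix c (τ • x)).rank = (evalMatrix c x).rank := by
  rw [evalMatrix_smul]
  exact Matrix.rank_smul_of_mem_nonZeroDivisors _ (mem_nonZeroDivisors_of_ne_zero hτ)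

lemma eval_det_submatrix_linMatrix {r : ℕ} (c : LinCoeff m n k) (x : Fin k → ℂ)
    (f : Fin r → Fin m) (g : Fin r → Fin n) :
    eval x ((linMatrix c).submatrix f g).det = ((evalMatrix c x).submatrix f g).det := by
  rw [RingHom.map_det, RingHom.mapMatrix_apply, ← Matrix.submatrix_map, map_eval_linMatrix]

lemma vecMul_evalMatrix {t N : ℕ} (c : LinCoeff t (t + 1) N) (s : Fin t → ℂ) (x : Fin N → ℂ) :
    s ᵥ* evalMatrix c x = evalMatrix (derivCoeff c) s *ᵥ x := by
  ext b
  simp only [Matrix.vecMul, dotProduct, Matrix.mulVec, evalMatrix, derivCoeff, Matrix.of_apply,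
    Finset.mul_sum, Finset.sum_mul]
  rw [Finset.sum_comm]
  exact Finset.sum_congr rfl fun _ _ => Finset.sum_congr rfl fun _ _ => by ring

end LinearForms

section Equations

/-- The equations `s i = 1` and `s ᵥ* F = 0` of the pairs of a matrix `F` and a hyperplane `s`
containing its columns, in the chart `s i = 1` of the projective space of hyperplanes. The index
`none` stands for the first of them. -/
def incidenceEqn {R m n : Type*} [CommRing R] [Fintype m] (F : Matrix m n R) (s : m → R) (i : m) :
    Option n → R
  | none => s i - 1
  | some b => (s ᵥ* F) b

lemma map_incidenceEqn {Φ R S m n : Type*} [CommRing R] [CommRing S] [FunLike Φ R S]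
    [RingHomClass Φ R S] [Fintype m] (φ : Φ) (F : Matrix m n R) (s : m → R) (i : m)
    (o : Option n) :
    φ (incidenceEqn F s i o) = incidenceEqn (F.map φ) (φ ∘ s) i o := by
  cases o with
  | none => simp [incidenceEqn]
  | some b => simp [incidenceEqn, Matrix.vecMul, dotProduct]

lemma incidenceEqn_eq_zero_iff {R m n : Type*} [CommRing R] [Fintype m] {F : Matrix m n R}
    {s : m → R} {i : m} : (∀ o, incidenceEqn F s i o = 0) ↔ s i = 1 ∧ s ᵥ* F = 0 := by
  simp [Option.forall, incidenceEqn, sub_eq_zero, funext_iff]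

/-- The equations, in the chart `s i = 1`, of the closure of the graph of the column span map. -/
def graphEqn (K : Type*) [CommRing K] {m n : Type*} [Fintype m] (i : m) :
    Option n → MvPolynomial ((m × n) ⊕ m) K :=
  incidenceEqn (Matrix.of fun a b => X (Sum.inl (a, b))) (fun a => X (Sum.inr a)) i

/-- A polynomial retraction onto the zero locus of `graphEqn`: the coordinate `s i` is replaced
by `1`, and the row `i` of the matrix by the combination of the other rows that the equations
prescribe. -/
def graphRetraction (K : Type*) [CommRing K] {m n : Type*} [Fintype m] [DecidableEq m] (i : m) :
    (m × n) ⊕ m → MvPolynomial ((m × n) ⊕ m) K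
  | Sum.inl p => if p.1 = i then
      -∑ a ∈ Finset.univ.erase i, X (Sum.inr a) * X (Sum.inl (a, p.2)) else X (Sum.inl p)
  | Sum.inr a => if a = i then 1 else X (Sum.inr a)

lemma mk_aeval_graphRetraction {K m n : Type*} [CommRing K] [Fintype m] [DecidableEq m] (i : m)
    (f : MvPolynomial ((m × n) ⊕ m) K) :
    Ideal.Quotient.mk (Ideal.span (Set.range (graphEqn K (n := n) i)))
      (aeval (graphRetraction K i) f) = Ideal.Quotient.mk _ f := by
  set I := Ideal.span (Set.range (graphEqn K (n := n) i)) with hI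
  have hEqn (o) : graphEqn K i o ∈ I := Ideal.subset_span ⟨o, rfl⟩
  suffices h : (Ideal.Quotient.mkₐ K I).comp (aeval (graphRetraction K i)) =
    Ideal.Quotient.mkₐ K I from congrArg (fun φ => φ f) h
  ext z
  simp only [AlgHom.comp_apply, aeval_X, Ideal.Quotient.mkₐ_eq_mk]
  rw [Ideal.Quotient.eq]
  rcases z with ⟨a, b⟩ | a <;> rcases eq_or_ne a i with rfl | ha
  · have hrow : graphRetraction K a (Sum.inl (a, b)) - X (Sum.inl (a, b)) =
        graphEqn K a none * X (Sum.inl (a, b)) - graphEqn K a (some b) := by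
      simp only [graphRetraction, if_true, graphEqn, incidenceEqn, Matrix.vecMul, dotProduct,
        Matrix.of_apply]
      rw [← Finset.add_sum_erase _ _ (Finset.mem_univ a)]
      ring
    rw [hrow]
    exact I.sub_mem (I.mul_mem_right _ (hEqn none)) (hEqn (some b))
  · simp [graphRetraction, ha]
  · have hone : graphRetraction K a (Sum.inr a) - X (Sum.inr a) =
        -graphEqn K (n := n) a none := by
      simp [graphRetraction, graphEqn, incidenceEqn]
    rw [hone]
    exact I.neg_mem (hEqn none)
  · simp [graphRetraction, ha]

lemma rank_add_one_eq_of_vecMul_eq_zero {K : Type*} [Field K] {m n : ℕ}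
    {B : Matrix (Fin (m + 1)) (Fin n) K} {s : Fin (m + 1) → K} (hs : s ≠ 0) (hsB : s ᵥ* B = 0)
    (f : Fin m → Fin (m + 1)) (g : Fin m → Fin n) (h : (B.submatrix f g).det ≠ 0) :
    B.rank + 1 = m + 1 := by
  have hlt := (rank_lt_card_iff_exists_vecMul B).2 ⟨s, hs, hsB⟩
  rw [Fintype.card_fin] at hlt
  exact le_antisymm hlt (Nat.succ_le_succ (le_rank_of_submatrix_det_ne_zero B f g h))

lemma eval_graphRetraction_mem {m n : ℕ} (i : Fin (m + 1))
    (w : (Fin (m + 1) × Fin n) ⊕ Fin (m + 1) → ℂ) (g : Fin m → Fin n)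
    (hw : (Matrix.of fun a b => w (Sum.inl (i.succAbove a, g b))).det ≠ 0) :
    (fun z => eval w (graphRetraction ℂ i z)) ∈ graphChart (m + 1) n i := by
  set B : Matrix (Fin (m + 1)) (Fin n) ℂ :=
    Matrix.of fun a b => eval w (graphRetraction ℂ i (Sum.inl (a, b))) with hB
  set s : Fin (m + 1) → ℂ :=
    fun a => eval w (graphRetraction ℂ (n := Fin n) i (Sum.inr a)) with hs
  have hsi : s i = 1 := by simp [hs, graphRetraction]
  have hsB : s ᵥ* B = 0 := by
    ext b
    have hne : ∀ a ∈ Finset.univ.erase i, s a * B a b = w (Sum.inr a) * w (Sum.inl (a, b)) := by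
      intro a ha
      simp [hs, hB, graphRetraction, Finset.ne_of_mem_erase ha]
    rw [Matrix.vecMul, dotProduct, ← Finset.add_sum_erase _ _ (Finset.mem_univ i),
      Finset.sum_congr rfl hne, hsi]
    simp [hB, graphRetraction]
  refine ⟨rank_add_one_eq_of_vecMul_eq_zero (fun h => ?_) hsB i.succAbove g ?_, hsi, congrFun hsB⟩
  · simp [h] at hsi
  · convert! hw using 2
    ext a b
    simp [graphRetraction, Fin.succAbove_ne]

theorem vanishingIdeal_graphChart {m n : ℕ} (hmn : m ≤ n + 1) (i : Fin m) :
    vanishingIdeal ℂ (graphChart m n i) = Ideal.span (Set.range (graphEqn ℂ i)) := by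
  apply le_antisymm
  · intro f hf
    rw [← Ideal.Quotient.eq_zero_iff_mem, ← mk_aeval_graphRetraction]
    suffices aeval (graphRetraction ℂ i) f = 0 by rw [this, map_zero]
    obtain ⟨m, rfl⟩ := Nat.exists_eq_add_one.2 i.pos
    let g : Fin m → Fin n := Fin.castLE (Nat.le_of_succ_le_succ hmn)
    let e : Fin m × Fin m → (Fin (m + 1) × Fin n) ⊕ Fin (m + 1) :=
      Sum.inl ∘ Prod.map i.succAbove g
    have he : Function.Injective e := Sum.inl_injective.comp
      (Fin.succAbove_right_injective.prodMap (Fin.castLE_injective _))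
    have hD : rename e (Matrix.mvPolynomialX (Fin m) (Fin m) ℂ).det ≠ 0 := by
      rw [Ne, map_eq_zero_iff _ (rename_injective _ he)]
      exact Matrix.det_mvPolynomialX_ne_zero (Fin m) ℂ
    refine (mul_eq_zero.1 (?_ : _ * aeval (graphRetraction ℂ i) f = 0)).resolve_left hD
    refine MvPolynomial.funext fun w => ?_
    rw [map_mul, map_zero, mul_eq_zero, or_iff_not_imp_left]
    intro hw
    have hmem := eval_graphRetraction_mem i w g (by
      rw [eval_rename, RingHom.map_det] at hw
      convert! hw using 2
      ext a b
      simp [Matrix.mvPolynomialX, e])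
    rw [← hf _ hmem, ← aeval_eq_eval, ← comp_aeval_apply]
  · rw [Ideal.span_le]
    rintro _ ⟨o, rfl⟩ z ⟨-, hz1, hz2⟩
    rw [aeval_eq_eval, graphEqn, map_incidenceEqn]
    refine incidenceEqn_eq_zero_iff.2 ⟨?_, ?_⟩ o
    · simpa using hz1
    · ext b
      simpa [Matrix.vecMul, dotProduct] using hz2 b

/-- The equations, in the chart `s i = 1`, of the Tjurina transform of the matrix `F`. -/
def tjurinaEqn {m n k : ℕ} (F : Matrix (Fin m) (Fin n) (MvPolynomial (Fin k) ℂ)) (i : Fin m) :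
    Option (Fin n) → MvPolynomial (Fin k ⊕ Fin m) ℂ :=
  incidenceEqn (F.map (rename Sum.inl)) (fun a => X (Sum.inr a)) i

theorem tjurinaIdeal_eq_span {m n k : ℕ} (hmn : m ≤ n + 1)
    (F : Matrix (Fin m) (Fin n) (MvPolynomial (Fin k) ℂ)) (i : Fin m) :
    tjurinaIdeal F i = Ideal.span (Set.range (tjurinaEqn F i)) := by
  rw [tjurinaIdeal, vanishingIdeal_graphChart hmn, Ideal.map_span, ← Set.range_comp]
  congr 2
  funext o
  refine (map_incidenceEqn _ _ _ _ _).trans ?_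
  congr 1 <;> ext <;> simp

end Equations

section TjurinaPoints

lemma exists_update_eval_ne_zero {K σ : Type*} [CommRing K] [IsDomain K] [Infinite K] {i : σ}
    {f g : MvPolynomial σ K} {p q : σ → K} (hpq : p i = q i) (hf : eval p f ≠ 0)
    (hg : eval q g ≠ 0) : ∃ y : σ → K, y i = p i ∧ eval y f ≠ 0 ∧ eval y g ≠ 0 := by
  classical
  let φ : MvPolynomial σ K →ₐ[K] MvPolynomial σ K := aeval (Function.update X i (C (p i)))
  have hφ (y : σ → K) (h : MvPolynomial σ K) :
      eval y (φ h) = eval (Function.update y i (p i)) h := by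
    simp only [φ, aeval_def, algebraMap_eq, eval_eval₂]
    congr 1
    · ext; simp
    · ext j
      rcases eq_or_ne j i with rfl | hj <;> simp [*]
  have hne : φ f * φ g ≠ 0 := by
    refine mul_ne_zero (fun h => hf ?_) (fun h => hg ?_)
    · rw [← Function.update_eq_self i p, ← hφ, h, map_zero]
    · rw [← Function.update_eq_self i q, ← hpq, ← hφ, h, map_zero]
  obtain ⟨y, hy⟩ : ∃ y, eval y (φ f * φ g) ≠ 0 := by
    by_contra! h
    exact hne (MvPolynomial.funext fun y => by rw [h, map_zero])
  rw [map_mul, hφ, hφ] at hy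
  exact ⟨Function.update y i (p i), Function.update_self .., left_ne_zero_of_mul hy,
    right_ne_zero_of_mul hy⟩

variable {t N : ℕ} (c : LinCoeff t (t + 1) N) {i : Fin t} {x : Fin N → ℂ} {s : Fin t → ℂ}

lemma eval_tjurinaEqn (o : Option (Fin (t + 1))) :
    eval (Sum.elim x s) (tjurinaEqn (linMatrix c) i o) = incidenceEqn (evalMatrix c x) s i o := by
  rw [tjurinaEqn, map_incidenceEqn, ← map_eval_linMatrix]
  congr 1 <;> ext <;> simp [eval_rename]

lemma tjurinaIdeal_linMatrix :
    tjurinaIdeal (linMatrix c) i = Ideal.span (Set.range (tjurinaEqn (linMatrix c) i)) :=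
  tjurinaIdeal_eq_span (by omega) _ i

lemma mem_zeroLocus_tjurinaIdeal_iff :
    Sum.elim x s ∈ zeroLocus ℂ (tjurinaIdeal (linMatrix c) i) ↔
      s i = 1 ∧ s ᵥ* evalMatrix c x = 0 := by
  rw [tjurinaIdeal_linMatrix, zeroLocus_span, ← incidenceEqn_eq_zero_iff]
  simp only [Set.mem_ofPred_eq, Set.forall_mem_range, aeval_eq_eval, eval_tjurinaEqn]

lemma grad_tjurinaEqn_none :
    grad (Sum.elim x s) (tjurinaEqn (linMatrix c) i none) =
      Sum.elim (0 : Fin N → ℂ) (Pi.single i 1) := by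
  ext (l | a) <;> simp [tjurinaEqn, incidenceEqn, Pi.single_apply, eq_comm]

lemma grad_tjurinaEqn_some (b : Fin (t + 1)) :
    grad (Sum.elim x s) (tjurinaEqn (linMatrix c) i (some b)) =
      Sum.elim (evalMatrix (derivCoeff c) s b) fun a => evalMatrix c x a b := by
  ext (l | a) <;> simp [tjurinaEqn, incidenceEqn, Matrix.vecMul, dotProduct, linMatrix, evalMatrix,
    derivCoeff, Derivation.leibniz, Pi.single_apply, mul_comm]

/- Pairing the `s`-part of a linear relation with `s` kills the rows of `M(x)`, since
`s ᵥ* M(x) = 0`, and leaves the coefficient of the gradient of `s i - 1`. -/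
theorem isSmoothPoint_tjurinaIdeal (hs : s i = 1) (hxs : s ᵥ* evalMatrix c x = 0)
    (h : ∀ v, v ᵥ* evalMatrix (derivCoeff c) s = 0 → evalMatrix c x *ᵥ v = 0 → v = 0) :
    IsSmoothPoint (tjurinaIdeal (linMatrix c) i) (Sum.elim x s) := by
  rw [tjurinaIdeal_linMatrix]
  refine isSmoothPoint_of_linearIndependent _ (fun o => ?_) ?_
  · rw [eval_tjurinaEqn, incidenceEqn_eq_zero_iff.2 ⟨hs, hxs⟩]
  rw [Fintype.linearIndependent_iff]
  intro a ha
  simp only [Fintype.sum_option, grad_tjurinaEqn_none, grad_tjurinaEqn_some] at ha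
  let v : Fin (t + 1) → ℂ := a ∘ some
  have hA : v ᵥ* evalMatrix (derivCoeff c) s = 0 := by
    ext l
    simpa [Matrix.vecMul, dotProduct, v] using congrFun ha (Sum.inl l)
  have hM : a none • Pi.single i 1 + evalMatrix c x *ᵥ v = 0 := by
    ext j
    simpa [Matrix.mulVec, dotProduct, v, Pi.single_apply, mul_comm] using congrFun ha (Sum.inr j)
  have hnone : a none = 0 := by
    have hdot := congrArg (s ⬝ᵥ ·) hM
    simpa [Matrix.dotProduct_mulVec, hxs, hs] using hdot
  have hv : v = 0 := h v hA (by simpa [hnone] using hM)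
  exact Option.forall.2 ⟨hnone, congrFun hv⟩

section ExceptionalFibre

variable {r : ℕ} {k : Fin r → Fin (t + 1)}

lemma sumElim_zero_mem_span {K l m : Type*} [CommSemiring K] {v : l → K} {S : Set (l → K)}
    (hv : v ∈ Submodule.span K S) :
    Sum.elim v (0 : m → K) ∈ Submodule.span K ((Sum.elim · (0 : m → K)) '' S) := by
  let φ : (l → K) →ₗ[K] (l ⊕ m → K) :=
    (LinearEquiv.sumArrowLequivProdArrow l m K K).symm.toLinearMap ∘ₗ LinearMap.inl K _ _
  exact Submodule.map_span φ S ▸ Submodule.mem_map_of_mem (f := φ) hv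

lemma incidenceEqn_evalMatrix_zero (hs : s i = 1) (o : Option (Fin (t + 1))) :
    incidenceEqn (evalMatrix c 0) s i o = 0 :=
  incidenceEqn_eq_zero_iff.2 ⟨hs, by rw [evalMatrix_zero, Matrix.vecMul_zero]⟩ o

lemma grad_tjurinaEqn_some_zero (s : Fin t → ℂ) (b : Fin (t + 1)) :
    grad (Sum.elim 0 s) (tjurinaEqn (linMatrix c) i (some b)) =
      Sum.elim (evalMatrix (derivCoeff c) s b) (0 : Fin t → ℂ) := by
  rw [grad_tjurinaEqn_some, evalMatrix_zero]
  rfl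

/-- The first equation of the Tjurina transform together with the equations that belong to the
columns `k j` of the matrix. -/
def selectedEqns {r : ℕ} (i : Fin t) (k : Fin r → Fin (t + 1)) :
    Set (MvPolynomial (Fin N ⊕ Fin t) ℂ) :=
  insert (tjurinaEqn (linMatrix c) i none)
    (Set.range fun j => tjurinaEqn (linMatrix c) i (some (k j)))

lemma eval_selectedEqns (hs : s i = 1) : ∀ f ∈ selectedEqns c i k, eval (Sum.elim 0 s) f = 0 := by
  rintro _ (rfl | ⟨j, rfl⟩) <;> rw [eval_tjurinaEqn, incidenceEqn_evalMatrix_zero c hs]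

lemma grad_mem_span_selectedEqns (hs : s i = 1)
    (hk : Submodule.span ℂ (Set.range ((evalMatrix (derivCoeff c) s).submatrix k id).row) =
      Submodule.span ℂ (Set.range (evalMatrix (derivCoeff c) s).row))
    {f : MvPolynomial (Fin N ⊕ Fin t) ℂ} (hf : f ∈ tjurinaIdeal (linMatrix c) i) :
    grad (Sum.elim 0 s) f ∈ Submodule.span ℂ (grad (Sum.elim 0 s) '' selectedEqns c i k) := by
  rw [tjurinaIdeal_linMatrix] at hf
  refine Submodule.span_le.2 ?_ (grad_mem_span_of_mem_span ?_ hf)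
  · rintro _ ⟨_, ⟨_ | b, rfl⟩, rfl⟩
    · exact Submodule.subset_span ⟨_, Or.inl rfl, rfl⟩
    have hb := sumElim_zero_mem_span (m := Fin t) (hk.ge (Submodule.subset_span ⟨b, rfl⟩))
    rw [SetLike.mem_coe, grad_tjurinaEqn_some_zero]
    refine Submodule.span_mono ?_ hb
    rintro _ ⟨_, ⟨j, rfl⟩, rfl⟩
    exact ⟨_, Or.inr ⟨j, rfl⟩, grad_tjurinaEqn_some_zero c s (k j)⟩
  · rintro _ ⟨o, rfl⟩
    rw [eval_tjurinaEqn, incidenceEqn_evalMatrix_zero c hs]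

lemma rank_evalMatrix_derivCoeff_le {g : MvPolynomial (Fin N ⊕ Fin t) ℂ} (hs : s i = 1)
    (hg : eval (Sum.elim 0 s) g ≠ 0)
    (hspan : ∀ b, g * tjurinaEqn (linMatrix c) i (some b) ∈ Ideal.span (selectedEqns c i k)) :
    (evalMatrix (derivCoeff c) s).rank ≤ r := by
  set A := evalMatrix (derivCoeff c) s
  have hrow (b : Fin (t + 1)) :
      A b ∈ Submodule.span ℂ (Set.range (A.submatrix k id).row) := by
    have hgrad := grad_mem_span_of_mem_span (eval_selectedEqns c hs) (hspan b)
    rw [grad_mul, eval_tjurinaEqn, incidenceEqn_evalMatrix_zero c hs, zero_smul, add_zero,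
      Submodule.smul_mem_iff _ hg] at hgrad
    have hmap := Submodule.mem_map_of_mem (f := LinearMap.funLeft ℂ ℂ Sum.inl) hgrad
    rw [Submodule.map_span, grad_tjurinaEqn_some] at hmap
    refine Submodule.span_le.2 ?_ hmap
    rintro _ ⟨_, ⟨_, rfl | ⟨j, rfl⟩, rfl⟩, rfl⟩
    · rw [grad_tjurinaEqn_none]
      exact Submodule.zero_mem _
    · rw [grad_tjurinaEqn_some]
      exact Submodule.subset_span ⟨j, rfl⟩
  rw [Matrix.rank_eq_finrank_span_row]
  calc Module.finrank ℂ (Submodule.span ℂ (Set.range A.row))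
      ≤ Module.finrank ℂ (Submodule.span ℂ (Set.range (A.submatrix k id).row)) :=
        Submodule.finrank_mono (Submodule.span_le.2 (Set.range_subset_iff.2 hrow))
    _ ≤ Fintype.card (Fin r) := finrank_range_le_card _
    _ = r := Fintype.card_fin r

/- Near a smooth point of the exceptional fibre, the rows of `A(s)` are spanned by as many of them
as at the point itself, so the rank of `A` there is maximal. -/
theorem rank_le_of_isSmoothPoint_tjurinaIdeal {s₀ s₁ : Fin t → ℂ} (h₀ : s₀ i = 1) (h₁ : s₁ i = 1)
    (h : IsSmoothPoint (tjurinaIdeal (linMatrix c) i) (Sum.elim 0 s₀)) :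
    (evalMatrix (derivCoeff c) s₁).rank ≤ (evalMatrix (derivCoeff c) s₀).rank := by
  have hmem (o) : tjurinaEqn (linMatrix c) i o ∈ tjurinaIdeal (linMatrix c) i := by
    rw [tjurinaIdeal_linMatrix]
    exact Ideal.subset_span ⟨o, rfl⟩
  obtain ⟨k, -, hk⟩ := exists_rows_linearIndependent (evalMatrix (derivCoeff c) s₀) rfl
  have hsel : selectedEqns c i k ⊆ tjurinaIdeal (linMatrix c) i := by
    rintro _ (rfl | ⟨j, rfl⟩) <;> exact hmem _
  have hzero : Sum.elim (0 : Fin N → ℂ) s₀ ∈ zeroLocus ℂ (tjurinaIdeal (linMatrix c) i) :=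
    (mem_zeroLocus_tjurinaIdeal_iff c).2
      (incidenceEqn_eq_zero_iff.1 (incidenceEqn_evalMatrix_zero c h₀))
  obtain ⟨g, hg₀, hg⟩ := h.exists_mul_mem_span hzero hsel
    fun f hf => grad_mem_span_selectedEqns c h₀ hk hf
  obtain ⟨f₁, f₂, hdet⟩ := exists_submatrix_det_ne_zero (evalMatrix (derivCoeff c) s₁) rfl
  rw [← eval_det_submatrix_linMatrix] at hdet
  have hg' (s : Fin t → ℂ) : eval s (aeval (Sum.elim 0 X) g) = eval (Sum.elim 0 s) g := by
    rw [aeval_def, eval_eval₂]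
    congr 1
    · ext; simp
    · ext (l | a) <;> simp
  rw [← hg'] at hg₀
  obtain ⟨s, hs, hgs, hdets⟩ := exists_update_eval_ne_zero (h₀.trans h₁.symm) hg₀ hdet
  rw [hg'] at hgs
  rw [eval_det_submatrix_linMatrix] at hdets
  exact (le_rank_of_submatrix_det_ne_zero _ _ _ hdets).trans
    (rank_evalMatrix_derivCoeff_le c (hs.trans h₀) hgs fun b => hg _ (hmem (some b)))

end ExceptionalFibre

end TjurinaPoints

section MinorGradients

lemma exists_intCast_mul_det_eq_submatrix_det {R n : Type*} [CommRing R] [Fintype n]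
    [DecidableEq n] (P : Matrix n n R) (f g : n → n) :
    ∃ a : ℤ, (P.submatrix f g).det = a * P.det := by
  have hcast (f g : n → n) : ((1 : Matrix n n R).submatrix f g).det =
      ((((1 : Matrix n n ℤ).submatrix f g).det : ℤ) : R) := by
    rw [← eq_intCast (Int.castRingHom R), RingHom.map_det, RingHom.mapMatrix_apply,
      ← Matrix.submatrix_map, Matrix.map_one _ (map_zero _) (map_one _)]
  have hmul : P.submatrix f g = (1 : Matrix n n R).submatrix f (Equiv.refl n) * P *
      (1 : Matrix n n R).submatrix (Equiv.refl n) g := by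
    rw [Matrix.one_submatrix_mul, Matrix.mul_submatrix_one]
    rfl
  refine ⟨((1 : Matrix n n ℤ).submatrix f id).det * ((1 : Matrix n n ℤ).submatrix id g).det, ?_⟩
  rw [hmul, Matrix.det_mul, Matrix.det_mul, hcast, hcast]
  push_cast
  simp only [Equiv.coe_refl]
  ring

/-- The maximal minor not using the `j`-th column. -/
def omitMinor {t : ℕ} {R : Type*} [CommRing R] (P : Matrix (Fin t) (Fin (t + 1)) R)
    (j : Fin (t + 1)) : R :=
  (P.submatrix id j.succAbove).det

lemma exists_submatrix_det_eq_intCast_mul_omitMinor {t : ℕ} {R : Type*} [CommRing R]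
    (P : Matrix (Fin t) (Fin (t + 1)) R) (f : Fin t → Fin t) (g : Fin t → Fin (t + 1)) :
    ∃ (j : Fin (t + 1)) (a : ℤ), (P.submatrix f g).det = a * omitMinor P j := by
  obtain ⟨j, hj⟩ : ∃ j, ∀ k, g k ≠ j := by
    by_contra! h
    simpa using Fintype.card_le_of_surjective g h
  choose g' hg' using fun k => Fin.exists_succAbove_eq (hj k)
  obtain ⟨a, ha⟩ := exists_intCast_mul_det_eq_submatrix_det (P.submatrix id j.succAbove) f g'
  refine ⟨j, a, ha ▸ congrArg Matrix.det ?_⟩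
  ext k l
  simp [hg']

variable {K σ : Type*} [CommRing K] {y : σ → K}

lemma grad_C_mul (a : K) (f : MvPolynomial σ K) : grad y (C a * f) = a • grad y f := by
  rw [C_mul', map_smul]

lemma grad_det_eq_zero {n : Type*} [Fintype n] [DecidableEq n] {P : Matrix n n (MvPolynomial σ K)}
    (a k : n) (h0 : P a k = 0) (hrow : ∀ l, eval y (P a l) = 0) (hcol : ∀ b, eval y (P b k) = 0) :
    grad y P.det = 0 := by
  rw [Matrix.det_apply, map_sum]
  refine Finset.sum_eq_zero fun τ _ => ?_
  rw [Units.smul_def, map_zsmul, ← Finset.mul_prod_erase _ _ (Finset.mem_univ k)]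
  rcases eq_or_ne (τ k) a with h | h
  · rw [h, h0, zero_mul, map_zero, smul_zero]
  · have hne : τ.symm a ≠ k := fun h' => h (by rw [← h', Equiv.apply_symm_apply])
    have hprod : eval y (∏ i ∈ Finset.univ.erase k, P (τ i) i) = 0 := by
      rw [map_prod]
      refine Finset.prod_eq_zero (Finset.mem_erase.2 ⟨hne, Finset.mem_univ _⟩) ?_
      rw [Equiv.apply_symm_apply, hrow]
    rw [grad_mul, hcol, hprod, zero_smul, zero_smul, add_zero, smul_zero]

/- Replacing a row by `s ᵥ* P` and then a column by the combination with coefficients `v`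
multiplies the determinant by nonzero constants, and makes `grad_det_eq_zero` apply. -/
lemma grad_det_eq_zero_of_vecMul_of_mulVec [IsDomain K] {n : Type*} [Fintype n] [DecidableEq n]
    {P : Matrix n n (MvPolynomial σ K)} {s v : n → K} (hs : s ≠ 0) (hv : v ≠ 0)
    (hsP : s ᵥ* P.map (eval y) = 0) (hPv : P.map (eval y) *ᵥ v = 0)
    (hsPv : (C ∘ s) ⬝ᵥ (P *ᵥ (C ∘ v)) = 0) : grad y P.det = 0 := by
  obtain ⟨a, ha⟩ := Function.ne_iff.1 hs
  obtain ⟨k, hk⟩ := Function.ne_iff.1 hv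
  let Q := P.updateRow a (∑ b, (C (s b) : MvPolynomial σ K) • P b)
  let Q' := Q.updateCol k (fun b => ∑ l, (C (v l) : MvPolynomial σ K) • Q b l)
  have hQ' : Q'.det = C (v k) * (C (s a) * P.det) := by
    rw [Matrix.det_updateCol_sum, Matrix.det_updateRow_sum, smul_eq_mul, smul_eq_mul]
  have hrow (l) : eval y (Q a l) = 0 := by
    simpa [Q, Matrix.vecMul, dotProduct] using congrFun hsP l
  have hcol (b) : eval y (Q' b k) = 0 := by
    rcases eq_or_ne b a with rfl | hb
    · simp [Q', hrow]
    · simpa [Q', Q, Matrix.updateRow_ne hb, Matrix.mulVec, dotProduct, mul_comm]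
        using congrFun hPv b
  have hrow' (l) : eval y (Q' a l) = 0 := by
    rcases eq_or_ne l k with rfl | hl
    · exact hcol a
    · simpa [Q', Matrix.updateCol_ne hl] using hrow l
  have hentry : Q' a k = 0 := by
    rw [← hsPv]
    simp only [smul_eq_mul, Matrix.updateCol_self, Matrix.updateRow_self, Finset.sum_apply,
      Pi.smul_apply, Finset.mul_sum, dotProduct, Function.comp_apply, Matrix.mulVec, Q', Q]
    rw [Finset.sum_comm]
    exact Finset.sum_congr rfl fun _ _ => Finset.sum_congr rfl fun _ _ => by ring
  have hgrad := grad_det_eq_zero a k hentry hrow' hcol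
  rw [hQ', grad_C_mul, grad_C_mul] at hgrad
  exact (smul_eq_zero.1 ((smul_eq_zero.1 hgrad).resolve_left hk)).resolve_left ha

/- The sum is the gradient of the determinant of `P` bordered by the constant row `w`. -/
lemma sum_smul_grad_omitMinor_eq_zero [IsDomain K] {t : ℕ}
    {P : Matrix (Fin t) (Fin (t + 1)) (MvPolynomial σ K)} {s : Fin t → K} (hs : s ≠ 0)
    {v : Fin (t + 1) → K} (hv : v ≠ 0) (hsP : s ᵥ* P.map (eval y) = 0)
    (hPv : P.map (eval y) *ᵥ v = 0) (hsPv : (C ∘ s) ⬝ᵥ (P *ᵥ (C ∘ v)) = 0) {w : Fin (t + 1) → K}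
    (hw : w ⬝ᵥ v = 0) : ∑ k : Fin (t + 1), ((-1) ^ (k : ℕ) * w k) • grad y (omitMinor P k) = 0 := by
  let Q : Matrix (Fin (t + 1)) (Fin (t + 1)) (MvPolynomial σ K) := Matrix.of (Fin.cons (C ∘ w) P)
  have hQ_zero (b) : Q 0 b = C (w b) := rfl
  have hQ_succ (a b) : Q (Fin.succ a) b = P a b := rfl
  have hdet : Q.det = ∑ k : Fin (t + 1), C ((-1) ^ (k : ℕ) * w k) * omitMinor P k := by
    rw [Matrix.det_succ_row_zero]
    refine Finset.sum_congr rfl fun k _ => ?_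
    rw [hQ_zero, map_mul, map_pow, map_neg, map_one]
    rfl
  have hgrad : grad y Q.det = 0 := by
    refine grad_det_eq_zero_of_vecMul_of_mulVec (s := Fin.cons 0 s) (fun h => hs ?_) hv ?_ ?_ ?_
    · ext a
      simpa using congrFun h a.succ
    · ext b
      simpa [Matrix.vecMul, dotProduct, Fin.sum_univ_succ (n := t), hQ_succ] using congrFun hsP b
    · ext a
      refine Fin.cases ?_ (fun a => ?_) a
      · simpa [Matrix.mulVec, dotProduct, hQ_zero] using hw
      · simpa [Matrix.mulVec, dotProduct, hQ_succ] using congrFun hPv a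
    · rw [dotProduct, Fin.sum_univ_succ]
      simpa [Matrix.mulVec, dotProduct, hQ_succ] using hsPv
  simpa only [hdet, map_sum, grad_C_mul] using hgrad

lemma grad_submatrix_det_mem_span {K : Type*} [Field K] {y : σ → K} {t : ℕ}
    {P : Matrix (Fin t) (Fin (t + 1)) (MvPolynomial σ K)} {s : Fin t → K} (hs : s ≠ 0)
    {v : Fin (t + 1) → K} {j : Fin (t + 1)} (hv : v j ≠ 0) (hsP : s ᵥ* P.map (eval y) = 0)
    (hPv : P.map (eval y) *ᵥ v = 0) (hsPv : (C ∘ s) ⬝ᵥ (P *ᵥ (C ∘ v)) = 0) (f : Fin t → Fin t)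
    (g : Fin t → Fin (t + 1)) :
    grad y (P.submatrix f g).det ∈ Submodule.span K {grad y (omitMinor P j)} := by
  obtain ⟨l, a, hl⟩ := exists_submatrix_det_eq_intCast_mul_omitMinor P f g
  rw [hl, ← zsmul_eq_mul, map_zsmul]
  refine zsmul_mem ?_ a
  have hw : (Pi.single l (v j) - Pi.single j (v l)) ⬝ᵥ v = 0 := by
    simp [sub_dotProduct, mul_comm]
  have hsum := sum_smul_grad_omitMinor_eq_zero hs (fun h => hv (congrFun h j)) hsP hPv hsPv hw
  simp only [Pi.sub_apply, mul_sub, sub_smul, Finset.sum_sub_distrib, Pi.single_apply, mul_ite,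
    mul_zero, ite_smul, zero_smul, Finset.sum_ite_eq', Finset.mem_univ, if_true] at hsum
  have hne : (-1) ^ (l : ℕ) * v j ≠ 0 := mul_ne_zero (pow_ne_zero _ (by simp)) hv
  rw [← Submodule.smul_mem_iff _ hne, sub_eq_zero.1 hsum]
  exact Submodule.smul_mem _ _ (Submodule.mem_span_singleton_self _)

end MinorGradients

/- Otherwise the gradients of all the maximal minors of `M` at `x` are proportional; since `X` is
smooth at `x`, its codimension is then at most 1. -/
theorem IsICMC2.eq_zero_of_vecMul_of_mulVec {t N : ℕ} {c : LinCoeff t (t + 1) N} (hc : IsICMC2 c)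
    {x : Fin N → ℂ} (hx : x ≠ 0) {s : Fin t → ℂ} (hs : s ≠ 0) (hxs : s ᵥ* evalMatrix c x = 0)
    {v : Fin (t + 1) → ℂ} (hvA : v ᵥ* evalMatrix (derivCoeff c) s = 0)
    (hxv : evalMatrix c x *ᵥ v = 0) : v = 0 := by
  by_contra hv
  obtain ⟨j, hj⟩ := Function.ne_iff.1 hv
  obtain ⟨⟨-, -, -, hheight⟩, hsing⟩ := hc
  have hzero : x ∈ zeroLocus ℂ (minorsIdeal (linMatrix c) t) :=
    mem_zeroLocus_minorsIdeal.2 ⟨s, hs, by rwa [map_eval_linMatrix]⟩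
  have hsmooth : IsSmoothPoint (minorsIdeal (linMatrix c) t) x := by
    by_contra h
    exact hx (hsing x ⟨hzero, h⟩)
  have hbilin : (C ∘ s) ⬝ᵥ (linMatrix c *ᵥ (C ∘ v)) = 0 := by
    refine MvPolynomial.funext fun w => ?_
    have hw : s ⬝ᵥ (evalMatrix c w *ᵥ v) = 0 := by
      rw [Matrix.dotProduct_mulVec, vecMul_evalMatrix, dotProduct_comm,
        Matrix.dotProduct_mulVec, hvA, zero_dotProduct]
    rw [map_zero, ← hw]
    simp [dotProduct, Matrix.mulVec, eval_linMatrix]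
  have hgrad : ∀ f ∈ minorsIdeal (linMatrix c) t,
      grad x f ∈ Submodule.span ℂ {grad x (omitMinor (linMatrix c) j)} := by
    intro f hf
    refine Submodule.span_le.2 ?_ (grad_mem_span_of_mem_span ?_ hf)
    · rintro _ ⟨_, ⟨f, g, rfl⟩, rfl⟩
      exact grad_submatrix_det_mem_span hs hj (by rwa [map_eval_linMatrix])
        (by rwa [map_eval_linMatrix]) hbilin f g
    · exact fun g hg => hzero g (Ideal.subset_span hg)
  have hle := hsmooth.height_le_one hzero (Ideal.subset_span ⟨id, j.succAbove, rfl⟩) hgrad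
  rw [hheight, Nat.sub_self, Nat.add_sub_cancel_left] at hle
  exact absurd hle (by decide)

section Generic

variable {ι κ : Type*} {P Q : (ι → ℂ) → Prop}

lemma Generic.mono (h : Generic P) (hPQ : ∀ c, P c → Q c) : Generic Q := by
  obtain ⟨G, hG, hGP⟩ := h
  exact ⟨G, hG, fun c hc => hPQ c (hGP c hc)⟩

lemma Generic.and (hP : Generic P) (hQ : Generic Q) : Generic fun c => P c ∧ Q c := by
  obtain ⟨G, hG, hGP⟩ := hP
  obtain ⟨H, hH, hHQ⟩ := hQ
  refine ⟨G * H, mul_ne_zero hG hH, fun c hc => ?_⟩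
  rw [map_mul] at hc
  exact ⟨hGP c (left_ne_zero_of_mul hc), hHQ c (right_ne_zero_of_mul hc)⟩

lemma Generic.forall_finite [Finite κ] {P : κ → (ι → ℂ) → Prop} (h : ∀ k, Generic (P k)) :
    Generic fun c => ∀ k, P k c := by
  have := Fintype.ofFinite κ
  choose G hG hGP using h
  refine ⟨∏ k, G k, Finset.prod_ne_zero_iff.2 fun k _ => hG k, fun c hc k => hGP k c ?_⟩
  rw [map_prod] at hc
  exact Finset.prod_ne_zero_iff.1 hc k (Finset.mem_univ k)

lemma Generic.comp (h : Generic P) {e : ι → κ} (he : Function.Injective e) :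
    Generic fun c : κ → ℂ => P (c ∘ e) := by
  obtain ⟨G, hG, hGP⟩ := h
  refine ⟨rename e G, ?_, fun c hc => hGP _ ?_⟩
  · rwa [Ne, map_eq_zero_iff _ (rename_injective e he)]
  · rwa [eval_rename] at hc

lemma Generic.derivCoeff {t N : ℕ} {Q : LinCoeff (t + 1) N t → Prop} (h : Generic Q) :
    Generic fun c : LinCoeff t (t + 1) N => Q (derivCoeff c) := by
  refine h.comp (e := fun p : Fin (t + 1) × Fin N × Fin t => (p.2.2, p.1, p.2.1)) ?_
  rintro ⟨a, b, d⟩ ⟨a', b', d'⟩ h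
  simp only [Prod.mk.injEq] at h ⊢
  tauto

lemma Generic.exists_of_eventually [Finite ι] (hP : Generic P) {c₀ : ι → ℂ}
    (hQ : ∀ᶠ c in nhds c₀, Q c) : ∃ c, P c ∧ Q c := by
  have := Fintype.ofFinite ι
  obtain ⟨G, hG, hGP⟩ := hP
  obtain ⟨ε, hε, hball⟩ := Metric.mem_nhds_iff.1 hQ
  by_contra! hPQ
  refine hG (funext_set (fun i => Metric.ball (c₀ i) ε)
    (fun i => infinite_of_mem_nhds _ (Metric.ball_mem_nhds _ hε)) fun c hc => ?_)
  rw [← ball_pi _ hε] at hc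
  rw [map_zero]
  by_contra hne
  exact hPQ c (hGP c hne) (hball hc)

end Generic

section Elimination

attribute [local instance] MvPolynomial.gradedAlgebra

lemma isHomogeneous_span_range {R σ κ : Type*} [CommRing R] {f : κ → MvPolynomial σ R} {d : κ → ℕ}
    (hf : ∀ j, (f j).IsHomogeneous (d j)) :
    (Ideal.span (Set.range f)).IsHomogeneous (homogeneousSubmodule σ R) := by
  apply Ideal.homogeneous_span
  rintro _ ⟨j, rfl⟩
  exact ⟨d j, hf j⟩

lemma exists_pow_idealOfVars_le {K σ : Type*} [Field K] [IsAlgClosed K] [Finite σ]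
    {I : Ideal (MvPolynomial σ K)} (h : ∀ s ∈ zeroLocus K I, s = 0) :
    ∃ d, idealOfVars σ K ^ d ≤ I := by
  refine Ideal.exists_pow_le_of_le_radical_of_fg ?_ (idealOfVars_fg σ K)
  rw [← vanishingIdeal_zeroLocus_eq_radical (K := K), idealOfVars, Ideal.span_le]
  rintro _ ⟨i, rfl⟩ s hs
  simp [h s hs]

lemma monomial_mem_idealOfVars_pow {R σ : Type*} [CommSemiring R] (μ : σ →₀ ℕ) (a : R) :
    monomial μ a ∈ idealOfVars σ R ^ μ.degree := by
  by_cases ha : a = 0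
  · simp [ha]
  · exact (monomial_mem_pow_idealOfVars_iff _ _ ha).2 le_rfl

section CoeffMatrix

variable {R σ : Type*} [CommRing R] {d : ℕ}

/-- The square matrix of the coefficients in degree `d` of a family of polynomials that is indexed
by the monomials of degree `d` themselves, as in Macaulay's construction of resultants. -/
def coeffMatrix (P : {μ : σ →₀ ℕ // μ.degree = d} → MvPolynomial σ R) :
    Matrix {μ : σ →₀ ℕ // μ.degree = d} {μ : σ →₀ ℕ // μ.degree = d} R :=
  Matrix.of fun μ ν => coeff ν.1 (P μ)

lemma coeffMatrix_monomial [DecidableEq {μ : σ →₀ ℕ // μ.degree = d}] :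
    coeffMatrix (fun μ : {μ : σ →₀ ℕ // μ.degree = d} => monomial μ.1 (1 : R)) = 1 := by
  classical
  ext μ ν
  simp [coeffMatrix, Matrix.one_apply, Subtype.ext_iff]

variable [Fintype {μ : σ →₀ ℕ // μ.degree = d}]

lemma map_det_coeffMatrix {S : Type*} [CommRing S] [DecidableEq {μ : σ →₀ ℕ // μ.degree = d}]
    (φ : R →+* S) (P : {μ : σ →₀ ℕ // μ.degree = d} → MvPolynomial σ R) :
    φ (coeffMatrix P).det = (coeffMatrix fun μ => map φ (P μ)).det := by
  rw [RingHom.map_det]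
  congr 1

lemma homogeneousComponent_eq_sum (p : MvPolynomial σ R) :
    homogeneousComponent d p =
      ∑ μ : {μ : σ →₀ ℕ // μ.degree = d}, monomial μ.1 (coeff μ.1 p) := by
  classical
  ext e
  simp only [coeff_homogeneousComponent, coeff_sum, coeff_monomial]
  split_ifs with he
  · rw [Fintype.sum_eq_single ⟨e, he⟩ fun μ hμ => if_neg fun h => hμ (Subtype.ext h), if_pos rfl]
  · exact (Finset.sum_eq_zero fun μ _ => if_neg fun h : μ.1 = e => he (h ▸ μ.2)).symm

lemma coeffMatrix_mulVec (P : {μ : σ →₀ ℕ // μ.degree = d} → MvPolynomial σ R) (s : σ → R) :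
    coeffMatrix P *ᵥ (fun ν => eval s (monomial ν.1 1)) =
      fun μ => eval s (homogeneousComponent d (P μ)) := by
  ext μ
  simp [homogeneousComponent_eq_sum, coeffMatrix, Matrix.mulVec, dotProduct, eval_monomial]

lemma eq_zero_of_det_coeffMatrix_ne_zero [IsDomain R]
    [DecidableEq {μ : σ →₀ ℕ // μ.degree = d}]
    {P : {μ : σ →₀ ℕ // μ.degree = d} → MvPolynomial σ R} (hP : (coeffMatrix P).det ≠ 0)
    {s : σ → R} (hs : ∀ μ, eval s (homogeneousComponent d (P μ)) = 0) : s = 0 := by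
  have hmon := Matrix.eq_zero_of_mulVec_eq_zero hP ((coeffMatrix_mulVec P s).trans (funext hs))
  ext i
  have hi : eval s (monomial (Finsupp.single i d) 1) = 0 :=
    congrFun hmon ⟨Finsupp.single i d, Finsupp.degree_single i d⟩
  rw [← X_pow_eq_monomial, map_pow, eval_X] at hi
  exact eq_zero_of_pow_eq_zero hi

end CoeffMatrix

lemma map_eval_sum_map_C_mul {ι σ κ K : Type*} [CommRing K] [Fintype κ]
    (a : κ → MvPolynomial σ K) (f : κ → MvPolynomial σ (MvPolynomial ι K)) (c : ι → K) :
    map (eval c) (∑ j, map C (a j) * f j) = ∑ j, a j * map (eval c) (f j) := by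
  have hC : (eval c).comp C = RingHom.id K := by
    ext
    simp
  simp only [map_sum, map_mul, map_map, hC, map_id]

/-- Elimination. If the system has only the trivial zero at `c₀`, then the Nullstellensatz writes
all monomials of some degree as combinations of its members there; the same combinations still
span that degree wherever their coefficient matrix remains invertible. -/
theorem generic_of_forall_eq_zero {ι σ κ : Type*} [Finite σ] [Finite κ] {d : κ → ℕ}
    (f : κ → MvPolynomial σ (MvPolynomial ι ℂ)) (hf : ∀ j, (f j).IsHomogeneous (d j))
    (c₀ : ι → ℂ) (h : ∀ s : σ → ℂ, (∀ j, eval s (map (eval c₀) (f j)) = 0) → s = 0) :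
    Generic fun c : ι → ℂ => ∀ s : σ → ℂ, (∀ j, eval s (map (eval c) (f j)) = 0) → s = 0 := by
  classical
  have := Fintype.ofFinite κ
  obtain ⟨D, hD⟩ := exists_pow_idealOfVars_le
    (I := Ideal.span (Set.range fun j => map (eval c₀) (f j))) fun s hs =>
      h s fun j => hs _ (Ideal.subset_span ⟨j, rfl⟩)
  have : Finite {μ : σ →₀ ℕ // μ.degree = D} :=
    (Finsupp.finite_of_degree_le D).subset fun μ (hμ : μ.degree = D) => hμ.le
  have := Fintype.ofFinite {μ : σ →₀ ℕ // μ.degree = D}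
  have hmem (μ : {μ : σ →₀ ℕ // μ.degree = D}) :
      ∃ a : κ → MvPolynomial σ ℂ, ∑ j, a j * map (eval c₀) (f j) = monomial μ.1 1 := by
    obtain ⟨μ, rfl⟩ := μ
    exact Ideal.mem_span_range_iff_exists_fun.1 (hD (monomial_mem_idealOfVars_pow μ 1))
  choose a ha using hmem
  let P (μ : {μ : σ →₀ ℕ // μ.degree = D}) : MvPolynomial σ (MvPolynomial ι ℂ) :=
    ∑ j, map C (a μ j) * f j
  have hP (c : ι → ℂ) (μ) : map (eval c) (P μ) = ∑ j, a μ j * map (eval c) (f j) :=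
    map_eval_sum_map_C_mul (a μ) f c
  refine ⟨(coeffMatrix P).det, fun h0 => ?_, fun c hc s hs =>
    eq_zero_of_det_coeffMatrix_ne_zero (map_det_coeffMatrix (eval c) P ▸ hc) fun μ => ?_⟩
  · have hone : eval c₀ (coeffMatrix P).det = 1 := by
      simp only [map_det_coeffMatrix, hP, ha, coeffMatrix_monomial, Matrix.det_one]
    rw [h0, map_zero] at hone
    exact zero_ne_one hone
  · have hker : Ideal.span (Set.range fun j => map (eval c) (f j)) ≤ RingHom.ker (eval s) :=
      Ideal.span_le.2 (Set.range_subset_iff.2 hs)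
    refine hker (homogeneousComponent_mem_of_mem
      (isHomogeneous_span_range fun j => (hf j).map (eval c)) ?_ D)
    rw [hP]
    exact Ideal.mem_span_range_iff_exists_fun.2 ⟨_, rfl⟩

end Elimination

section FullRank

variable {m n k : ℕ}

/-- The matrix of linear forms with coefficients `c` has linearly independent rows at every nonzero
point. -/
def FullRank (c : LinCoeff m n k) : Prop :=
  ∀ s ≠ 0, ∀ v, v ᵥ* evalMatrix c s = 0 → v = 0

lemma not_fullRank_iff {c : LinCoeff m n k} :
    ¬ FullRank c ↔ ∃ s ≠ 0, ∃ v ≠ 0, v ᵥ* evalMatrix c s = 0 := by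
  simp only [FullRank, not_forall, exists_prop, and_comm, ne_eq]

lemma fullRank_iff_det {c : LinCoeff m n k} :
    FullRank c ↔ ∀ s, (∀ p : (Fin m → Fin m) × (Fin m → Fin n),
      ((evalMatrix c s).submatrix p.1 p.2).det = 0) → s = 0 := by
  refine forall_congr' fun s => ?_
  rw [Prod.forall, submatrix_det_eq_zero_iff_exists_vecMul, ← not_imp_not]
  simp only [not_forall, exists_prop, and_comm, ne_eq, not_not]

lemma isHomogeneous_det {R σ ι : Type*} [CommRing R] [Fintype ι] [DecidableEq ι] {d : ℕ}
    {P : Matrix ι ι (MvPolynomial σ R)} (hP : ∀ i j, (P i j).IsHomogeneous d) :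
    P.det.IsHomogeneous (Fintype.card ι * d) := by
  rw [Matrix.det_apply]
  refine IsHomogeneous.sum _ _ _ fun τ _ => ?_
  have hprod := IsHomogeneous.prod Finset.univ (fun i => P (τ i) i) (fun _ => d) fun i _ => hP _ _
  rw [Finset.sum_const, Finset.card_univ, smul_eq_mul] at hprod
  exact (homogeneousSubmodule σ R _).toAddSubgroup.zsmul_mem hprod _

/-- The matrix of linear forms whose coefficients are independent variables. -/
def genericLinMatrix (m n k : ℕ) :
    Matrix (Fin m) (Fin n) (MvPolynomial (Fin k) (MvPolynomial (Fin m × Fin n × Fin k) ℂ)) :=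
  Matrix.of fun i j => ∑ l, C (X (i, j, l)) * X l

lemma isHomogeneous_genericLinMatrix (i : Fin m) (j : Fin n) :
    (genericLinMatrix m n k i j).IsHomogeneous 1 := by
  rw [genericLinMatrix, Matrix.of_apply]
  exact IsHomogeneous.sum _ _ _ fun _ _ => isHomogeneous_C_mul_X _ _

lemma eval_map_det_genericLinMatrix {r : ℕ} (c : LinCoeff m n k) (s : Fin k → ℂ)
    (f : Fin r → Fin m) (g : Fin r → Fin n) :
    eval s (map (eval c) ((genericLinMatrix m n k).submatrix f g).det) =
      ((evalMatrix c s).submatrix f g).det := by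
  rw [RingHom.map_det, RingHom.map_det]
  congr 1
  ext i j
  simp [genericLinMatrix, evalMatrix]

theorem FullRank.generic {c₀ : LinCoeff m n k} (h : FullRank c₀) :
    Generic fun c : LinCoeff m n k => FullRank c := by
  simp only [fullRank_iff_det, ← eval_map_det_genericLinMatrix] at h ⊢
  exact generic_of_forall_eq_zero (fun p : (Fin m → Fin m) × (Fin m → Fin n) =>
    ((genericLinMatrix m n k).submatrix p.1 p.2).det)
    (fun p => isHomogeneous_det fun _ _ => isHomogeneous_genericLinMatrix _ _) c₀ h

end FullRank

section Toeplitz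

variable {m n k : ℕ}

/-- The coefficients of the matrix of linear forms `(x_(j - i))`, whose vector products are the
coefficients of products of polynomials. -/
def toeplitzCoeff (m n k : ℕ) : LinCoeff m n k :=
  fun p => if (p.2.1 : ℕ) = p.1 + p.2.2 then 1 else 0

lemma vecMul_evalMatrix_toeplitzCoeff (v : Fin m → ℂ) (s : Fin k → ℂ) (l : Fin n) :
    (v ᵥ* evalMatrix (toeplitzCoeff m n k) s) l =
      (Polynomial.ofFn m v * Polynomial.ofFn k s).coeff l := by
  simp only [Polynomial.ofFn_eq_sum_monomial, Finset.sum_mul_sum, Polynomial.monomial_mul_monomial,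
    Polynomial.finsetSum_coeff, Polynomial.coeff_monomial]
  simp [Matrix.vecMul, dotProduct, evalMatrix, toeplitzCoeff, Finset.mul_sum, eq_comm]

/-- A product of nonzero polynomials of degrees `< m` and `< k` is nonzero, and its degree
is `< n`. -/
lemma fullRank_toeplitzCoeff (h : m + k ≤ n + 1) : FullRank (toeplitzCoeff m n k) := by
  intro s hs v hv
  by_contra hv0
  have hp : Polynomial.ofFn m v ≠ 0 := (map_ne_zero_iff _ (Polynomial.injective_ofFn m)).2 hv0
  have hq : Polynomial.ofFn k s ≠ 0 := (map_ne_zero_iff _ (Polynomial.injective_ofFn k)).2 hs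
  have hpm := (Polynomial.natDegree_lt_iff_degree_lt hp).2 (Polynomial.ofFn_degree_lt v)
  have hqk := (Polynomial.natDegree_lt_iff_degree_lt hq).2 (Polynomial.ofFn_degree_lt s)
  have hpq := Polynomial.natDegree_mul hp hq
  have hn : (Polynomial.ofFn m v * Polynomial.ofFn k s).natDegree < n := by omega
  exact Polynomial.leadingCoeff_ne_zero.2 (mul_ne_zero hp hq)
    ((vecMul_evalMatrix_toeplitzCoeff v s ⟨_, hn⟩).symm.trans (congrFun hv _))

lemma generic_fullRank (h : m + k ≤ n + 1) : Generic fun c : LinCoeff m n k => FullRank c :=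
  (fullRank_toeplitzCoeff h).generic

end Toeplitz

section Bilinear

variable {m a : ℕ}

/-- Affine coordinates `y` on `ℙ^a × ℙ^m`: the homogeneous coordinates on the first factor. -/
def affLeft (y : Fin (a + m) → ℂ) : Fin (a + 1) → ℂ := Fin.cons 1 fun i => y (Fin.castAdd m i)

/-- Affine coordinates `y` on `ℙ^a × ℙ^m`: the homogeneous coordinates on the second factor. -/
def affRight (y : Fin (a + m) → ℂ) : Fin (m + 1) → ℂ := Fin.cons 1 fun j => y (Fin.natAdd a j)

/-- The system of bilinear forms `x_i * y_0`, `x_0 * y_j`, which restricts to the identity in the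
affine coordinates `x_0 = y_0 = 1`. -/
def affCoeff : LinCoeff (m + 1) (a + m) (a + 1) := fun p =>
  Fin.addCases (fun i => if p.1 = 0 ∧ p.2.2 = i.succ then 1 else 0)
    (fun j => if p.1 = j.succ ∧ p.2.2 = 0 then 1 else 0) p.2.1

/-- The values of a system of bilinear forms in affine coordinates. -/
def bilinValue (z : LinCoeff (m + 1) (a + m) (a + 1) × (Fin (a + m) → ℂ)) : Fin (a + m) → ℂ :=
  affRight z.2 ᵥ* evalMatrix z.1 (affLeft z.2)

lemma bilinValue_affCoeff (y : Fin (a + m) → ℂ) : bilinValue (affCoeff, y) = y := by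
  ext l
  induction l using Fin.addCases <;>
    simp [bilinValue, Matrix.vecMul, dotProduct, evalMatrix, affCoeff, affRight, affLeft,
      Fin.sum_univ_succ, Fin.succ_ne_zero, (Fin.succ_ne_zero _).symm]

lemma contDiff_affLeft : ContDiff ℂ 1 (affLeft (m := m) (a := a)) := by
  refine contDiff_pi.2 fun i => ?_
  cases i using Fin.cases <;> simp only [affLeft, Fin.cons_zero, Fin.cons_succ] <;> fun_prop

lemma contDiff_affRight : ContDiff ℂ 1 (affRight (m := m) (a := a)) := by
  refine contDiff_pi.2 fun i => ?_
  cases i using Fin.cases <;> simp only [affRight, Fin.cons_zero, Fin.cons_succ] <;> fun_prop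

lemma contDiff_bilinValue : ContDiff ℂ 1 (bilinValue (m := m) (a := a)) := by
  have hl := contDiff_pi.1 (contDiff_affLeft (m := m) (a := a))
  have hr := contDiff_pi.1 (contDiff_affRight (m := m) (a := a))
  refine contDiff_pi.2 fun l => ?_
  simp only [bilinValue, Matrix.vecMul, dotProduct, evalMatrix, Matrix.of_apply]
  fun_prop

lemma eventually_exists_bilinValue_eq_zero :
    ∀ᶠ c in nhds (affCoeff : LinCoeff (m + 1) (a + m) (a + 1)), ∃ y, bilinValue (c, y) = 0 := by
  let z₀ : LinCoeff (m + 1) (a + m) (a + 1) × (Fin (a + m) → ℂ) := (affCoeff, 0)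
  have hderiv : HasStrictFDerivAt bilinValue (fderiv ℂ bilinValue z₀) z₀ :=
    contDiff_bilinValue.contDiffAt.hasStrictFDerivAt one_ne_zero
  have hpartial : fderiv ℂ bilinValue z₀ ∘L .inr ℂ _ _ = .id ℂ _ := by
    have hcomp :=
      hderiv.hasFDerivAt.comp (0 : Fin (a + m) → ℂ) (hasFDerivAt_prodMk_right affCoeff 0)
    exact hcomp.unique ((hasFDerivAt_id 0).congr_of_eventuallyEq
      (.of_forall bilinValue_affCoeff))
  have himplicit := hderiv.eventually_apply_implicitFunctionOfProdDomain
    (hpartial ▸ ⟨.refl ℂ _, rfl⟩)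
  filter_upwards [himplicit] with c hc
  exact ⟨_, hc.trans (bilinValue_affCoeff 0)⟩

lemma not_fullRank_add (c : LinCoeff (m + 1) (a + m) (a + 1)) : ¬ FullRank c := by
  intro h
  obtain ⟨c', hc', y, hy⟩ := h.generic.exists_of_eventually eventually_exists_bilinValue_eq_zero
  have hleft : affLeft y ≠ 0 := fun h0 => one_ne_zero (congrFun h0 0)
  exact one_ne_zero (congrFun (hc' _ hleft _ hy) 0)

theorem not_fullRank {n k : ℕ} (hm : 0 < m) (hk : 0 < k) (hn : n + 2 ≤ m + k)
    (c : LinCoeff m n k) : ¬ FullRank c := by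
  obtain ⟨m, rfl⟩ := Nat.exists_eq_succ_of_ne_zero hm.ne'
  obtain ⟨a, rfl⟩ := Nat.exists_eq_succ_of_ne_zero hk.ne'
  let c' : LinCoeff (m + 1) (a + m) (a + 1) := fun p =>
    if h : (p.2.1 : ℕ) < n then c (p.1, ⟨p.2.1, h⟩, p.2.2) else 0
  obtain ⟨s, hs, v, hv, hvs⟩ := not_fullRank_iff.1 (not_fullRank_add c')
  refine not_fullRank_iff.2 ⟨s, hs, v, hv, ?_⟩
  ext l
  simpa [Matrix.vecMul, dotProduct, evalMatrix, c'] using congrFun hvs ⟨l, by omega⟩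

end Bilinear

section Integral

variable {R S : Type*} [CommRing R] [CommRing S] [Algebra R S]

lemma height_comap_le_of_hasGoingDown [IsNoetherianRing R] [IsNoetherianRing S]
    [Algebra.HasGoingDown R S] (Q : Ideal S) [Q.IsPrime] :
    (Q.comap (algebraMap R S)).height ≤ Q.height := by
  have : Q.LiesOver (Q.comap (algebraMap R S)) := ⟨rfl⟩
  rw [Ideal.height_eq_height_add_of_liesOver_of_hasGoingDown (Q.comap (algebraMap R S)) Q]
  exact le_self_add

variable [Algebra.IsIntegral R S]

lemma strictMono_comap_of_isIntegral : StrictMono (PrimeSpectrum.comap (algebraMap R S)) :=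
  fun _ _ h => Ideal.IsIntegral.comap_lt_comap h

lemma height_le_height_comap_of_isIntegral (Q : Ideal S) [Q.IsPrime] :
    Q.height ≤ (Q.comap (algebraMap R S)).height := by
  have h := Order.height_le_height_apply_of_strictMono _
    (strictMono_comap_of_isIntegral (R := R) (S := S)) ⟨Q, ‹_›⟩
  rwa [← PrimeSpectrum.height_eq_orderHeight, ← PrimeSpectrum.height_eq_orderHeight] at h

lemma ringKrullDim_le_of_isIntegral : ringKrullDim S ≤ ringKrullDim R :=
  Order.krullDim_le_of_strictMono _ strictMono_comap_of_isIntegral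

lemma ringKrullDim_eq_of_isIntegral_of_injective (h : Function.Injective (algebraMap R S)) :
    ringKrullDim S = ringKrullDim R := by
  refine le_antisymm ringKrullDim_le_of_isIntegral (iSup_le fun l => ?_)
  have hker : (⊥ : Ideal S).comap (algebraMap R S) ≤ l.head.asIdeal := by
    rw [← RingHom.ker_eq_comap_bot, (RingHom.injective_iff_ker_eq_bot _).1 h]
    exact bot_le
  obtain ⟨Q, -, hQ, hQl⟩ := Ideal.exists_ideal_over_prime_of_isIntegral l.head.asIdeal _ hker
  have : Q.LiesOver l.head.asIdeal := ⟨hQl.symm⟩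
  obtain ⟨L, hL, -⟩ := Ideal.exists_ltSeries_of_hasGoingUp l Q
  rw [← hL]
  exact Order.LTSeries.length_le_krullDim L

end Integral

section CoordIdeal

variable {ι K : Type*} [CommRing K]

/-- The homomorphism setting the variables in `s` to zero. -/
def killVars (K : Type*) [CommRing K] (s : Finset ι) :
    MvPolynomial ι K →ₐ[K] MvPolynomial {i // i ∉ s} K :=
  killCompl Subtype.val_injective

/-- The ideal of the coordinate subspace on which the coordinates in `s` vanish. -/
def coordIdeal (K : Type*) [CommRing K] (s : Finset ι) : Ideal (MvPolynomial ι K) :=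
  RingHom.ker (killVars K s)

instance [IsDomain K] (s : Finset ι) : (coordIdeal K s).IsPrime := RingHom.ker_isPrime _

lemma killVars_rename_val (s : Finset ι) (f : MvPolynomial {i // i ∉ s} K) :
    killVars K s (rename Subtype.val f) = f :=
  killCompl_rename_app Subtype.val_injective f

lemma killVars_X_of_mem {s : Finset ι} {i : ι} (hi : i ∈ s) : killVars K s (X i) = 0 := by
  rw [killVars, killCompl, aeval_X, dif_neg (by simpa using hi)]

lemma killVars_X_of_notMem {s : Finset ι} {i : ι} (hi : i ∉ s) :
    killVars K s (X i) = X ⟨i, hi⟩ := by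
  rw [← killVars_rename_val s (X ⟨i, hi⟩), rename_X]

lemma eval_killVars [DecidableEq ι] (s : Finset ι) (v : {i // i ∉ s} → K) (f : MvPolynomial ι K) :
    eval v (killVars K s f) = eval (fun i => if h : i ∈ s then 0 else v ⟨i, h⟩) f := by
  induction f using MvPolynomial.induction_on with
  | C a => simp
  | add p q hp hq => simp [hp, hq]
  | mul_X p i hp =>
    by_cases hi : i ∈ s
    · simp [killVars_X_of_mem hi, hi]
    · simp [killVars_X_of_notMem hi, hi, hp]

lemma X_mem_coordIdeal [Nontrivial K] {s : Finset ι} {i : ι} : X i ∈ coordIdeal K s ↔ i ∈ s := by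
  rw [coordIdeal, RingHom.mem_ker]
  refine ⟨fun h => ?_, killVars_X_of_mem⟩
  by_contra hi
  exact X_ne_zero _ ((killVars_X_of_notMem hi).symm.trans h)

lemma coordIdeal_eq_span (s : Finset ι) : coordIdeal K s = Ideal.span (X '' (s : Set ι)) := by
  set J : Ideal (MvPolynomial ι K) := Ideal.span (X '' (s : Set ι))
  apply le_antisymm
  · have hmod : (Ideal.Quotient.mkₐ K J).comp ((rename Subtype.val).comp (killVars K s)) =
        Ideal.Quotient.mkₐ K J := by
      ext i
      simp only [AlgHom.comp_apply]
      by_cases hi : i ∈ s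
      · rw [killVars_X_of_mem hi, map_zero, map_zero, eq_comm]
        exact Ideal.Quotient.eq_zero_iff_mem.2 (Ideal.subset_span ⟨i, hi, rfl⟩)
      · rw [killVars_X_of_notMem hi, rename_X]
    intro f hf
    have hf0 := DFunLike.congr_fun hmod f
    rw [AlgHom.comp_apply, AlgHom.comp_apply, show killVars K s f = 0 from hf, map_zero,
      map_zero] at hf0
    exact Ideal.Quotient.eq_zero_iff_mem.1 hf0.symm
  · rw [Ideal.span_le]
    rintro _ ⟨i, hi, rfl⟩
    exact killVars_X_of_mem hi

lemma height_coordIdeal [IsDomain K] [IsNoetherianRing K] [Finite ι] (s : Finset ι) :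
    (coordIdeal K s).height = s.card := by
  classical
  apply le_antisymm
  · refine (Ideal.height_le_spanFinrank _ Ideal.IsPrime.ne_top').trans ?_
    rw [coordIdeal_eq_span]
    refine Nat.cast_le.2 ((Submodule.spanFinrank_span_le_ncard_of_finite
      (s.finite_toSet.image _)).trans ?_)
    exact (Set.ncard_image_le s.finite_toSet).trans (Set.ncard_coe_finset s).le
  · induction s using Finset.induction_on with
    | empty => simp
    | insert i s hi ih =>
      have hlt : coordIdeal K s < coordIdeal K (insert i s) := by
        refine lt_of_le_of_ne ?_ fun h => hi ?_
        · rw [coordIdeal_eq_span, coordIdeal_eq_span]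
          exact Ideal.span_mono (Set.image_mono (by simp))
        · rw [← X_mem_coordIdeal (K := K), h, X_mem_coordIdeal]
          exact Finset.mem_insert_self _ _
      rw [Finset.card_insert_of_notMem hi, Nat.cast_add, Nat.cast_one]
      exact (add_le_add_left ih 1).trans (Ideal.height_add_one_le_of_lt_of_isPrime hlt)

end CoordIdeal

section HomogeneousParameters

section Finite

attribute [local instance] MvPolynomial.gradedAlgebra

variable {R σ ι : Type*} [CommRing R]

lemma homogeneousComponent_mul_of_isHomogeneous {g : MvPolynomial σ R} {e : ℕ}
    (hg : g.IsHomogeneous e) (f : MvPolynomial σ R) (n : ℕ) :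
    homogeneousComponent n (f * g) =
      (if e ≤ n then homogeneousComponent (n - e) f else 0) * g := by
  rw [ite_mul, zero_mul]
  simp only [← decomposition.decompose'_apply]
  exact DirectSum.coe_decompose_mul_of_right_mem (homogeneousSubmodule σ R) n hg

lemma exists_sum_mul_eq_of_mem_span_range [Fintype ι] {g : ι → MvPolynomial σ R} {e : ι → ℕ}
    (hg : ∀ i, (g i).IsHomogeneous (e i)) {f : MvPolynomial σ R} {n : ℕ} (hf : f.IsHomogeneous n)
    (hmem : f ∈ Ideal.span (Set.range g)) :
    ∃ h : ι → MvPolynomial σ R, ∑ i, h i * g i = f ∧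
      ∀ i, ∀ ν ∈ (h i).support, ν.degree + e i = n := by
  obtain ⟨h, rfl⟩ := Ideal.mem_span_range_iff_exists_fun.1 hmem
  refine ⟨fun i => if e i ≤ n then homogeneousComponent (n - e i) (h i) else 0, ?_, ?_⟩
  · simp only [← homogeneousComponent_mul_of_isHomogeneous (hg _), ← map_sum]
    exact homogeneousComponent_eq_self hf
  · intro i ν hν
    dsimp only at hν
    split_ifs at hν with hi
    · have hdeg : ν.degree = n - e i := by
        rw [Finsupp.degree_eq_weight_one]
        exact homogeneousComponent_isHomogeneous _ (h i) (mem_support_iff.1 hν)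
      omega
    · simp at hν

lemma moduleFinite_of_idealOfVars_pow_le {A : Type*} [CommRing A] [Algebra R A]
    [Algebra A (MvPolynomial σ R)] [IsScalarTower R A (MvPolynomial σ R)] [Finite σ] [Finite ι]
    {a : ι → A} {e : ι → ℕ} (he : ∀ i, 0 < e i)
    (ha : ∀ i, (algebraMap A (MvPolynomial σ R) (a i)).IsHomogeneous (e i)) {d : ℕ}
    (hd : idealOfVars σ R ^ d ≤
      Ideal.span (Set.range fun i => algebraMap A (MvPolynomial σ R) (a i))) :
    Module.Finite A (MvPolynomial σ R) := by
  have := Fintype.ofFinite ι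
  let B : Set (MvPolynomial σ R) := (fun μ => monomial μ 1) '' {μ : σ →₀ ℕ | μ.degree ≤ d}
  have hB : B.Finite := (Finsupp.finite_of_degree_le d).image _
  let M : Submodule A (MvPolynomial σ R) := Submodule.span A B
  have hmon (n : ℕ) : ∀ μ : σ →₀ ℕ, μ.degree = n → ∀ r, monomial μ r ∈ M := by
    induction n using Nat.strong_induction_on with
    | _ n ih =>
      rintro μ rfl r
      by_cases hμ : μ.degree ≤ d
      · rw [← mul_one r, ← smul_eq_mul, ← smul_monomial, ← algebraMap_smul A]
        exact M.smul_mem _ (Submodule.subset_span ⟨μ, hμ, rfl⟩)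
      have hmem := hd (Ideal.pow_le_pow_right (not_le.1 hμ).le (monomial_mem_idealOfVars_pow μ r))
      obtain ⟨h, hsum, hdeg⟩ :=
        exists_sum_mul_eq_of_mem_span_range ha (isHomogeneous_monomial r rfl) hmem
      rw [← hsum]
      refine M.sum_mem fun i _ => ?_
      rw [mul_comm, ← Algebra.smul_def, (h i).as_sum]
      refine M.smul_mem _ (M.sum_mem fun ν hν => ih _ ?_ ν rfl _)
      have := he i
      have := hdeg i ν hν
      omega
  have htop : M = ⊤ := by
    refine eq_top_iff.2 fun f _ => ?_
    rw [f.as_sum]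
    exact M.sum_mem fun ν _ => hmon _ ν rfl _
  exact ⟨⟨hB.toFinset, by rwa [hB.coe_toFinset]⟩⟩

end Finite

variable {σ ι K : Type*} [Field K]

lemma injective_of_isIntegral [Finite σ] [Finite ι] (hcard : Nat.card ι ≤ Nat.card σ)
    {φ : MvPolynomial ι K →ₐ[K] MvPolynomial σ K} (hφ : φ.toRingHom.IsIntegral) :
    Function.Injective φ := by
  rw [injective_iff_map_eq_zero]
  by_contra! h
  obtain ⟨r, hr, hr0⟩ := h
  let _ : Algebra φ.range (MvPolynomial σ K) := φ.range.val.toRingHom.toAlgebra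
  have : Algebra.IsIntegral φ.range (MvPolynomial σ K) :=
    ⟨RingHom.IsIntegral.tower_top φ.rangeRestrict.toRingHom φ.range.val.toRingHom hφ⟩
  have hrange := ringKrullDim_succ_le_of_surjective φ.rangeRestrict.toRingHom
    φ.rangeRestrict_surjective (mem_nonZeroDivisors_of_ne_zero hr0) (Subtype.ext hr)
  have hdim := ringKrullDim_le_of_isIntegral (R := φ.range) (S := MvPolynomial σ K)
  rw [MvPolynomial.ringKrullDim_of_isNoetherianRing, ringKrullDim_eq_zero_of_field, zero_add]
    at hrange hdim
  have hlt : ((Nat.card σ + 1 : ℕ) : WithBot ℕ∞) ≤ Nat.card ι :=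
    (add_le_add_left hdim 1).trans hrange
  exact (Nat.cast_le.1 hlt).not_gt (Nat.lt_succ_of_le hcard)

lemma killVars_eq_zero_of_aeval_mem [Infinite K] {g : ι → MvPolynomial σ K} {s : Finset ι}
    {I : Ideal (MvPolynomial σ K)}
    (hI : ∀ v : ι → K, (∀ i ∈ s, v i = 0) → ∃ z ∈ zeroLocus K I, ∀ i, eval z (g i) = v i)
    {h : MvPolynomial ι K} (hh : aeval g h ∈ vanishingIdeal K (zeroLocus K I)) :
    killVars K s h = 0 := by
  classical
  apply MvPolynomial.funext
  intro v
  obtain ⟨z, hz, hzv⟩ := hI (fun i => if h : i ∈ s then 0 else v ⟨i, h⟩) fun i hi => dif_pos hi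
  rw [eval_killVars, map_zero, ← _root_.funext hzv, ← hh z hz]
  exact (comp_aeval_apply g (aeval z) h).symm

/-- A homogeneous system of parameters: as many homogeneous polynomials of positive degrees as there
are variables, without common zeros except the origin. -/
structure IsHomogeneousParameters (g : ι → MvPolynomial σ K) : Prop where
  card_eq : Nat.card ι = Nat.card σ
  exists_isHomogeneous : ∀ i, ∃ d, 0 < d ∧ (g i).IsHomogeneous d
  eq_zero : ∀ z : σ → K, (∀ i, eval z (g i) = 0) → z = 0

namespace IsHomogeneousParameters

variable [IsAlgClosed K] [Finite σ] {g : ι → MvPolynomial σ K}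

lemma isIntegral [Finite ι] (hg : IsHomogeneousParameters g) :
    (aeval g : MvPolynomial ι K →ₐ[K] MvPolynomial σ K).toRingHom.IsIntegral := by
  choose e he hge using hg.exists_isHomogeneous
  obtain ⟨d, hd⟩ := exists_pow_idealOfVars_le (I := Ideal.span (Set.range g)) fun z hz =>
    hg.eq_zero z fun i => hz _ (Ideal.subset_span ⟨i, rfl⟩)
  let _ : Algebra (MvPolynomial ι K) (MvPolynomial σ K) :=
    (aeval g : MvPolynomial ι K →ₐ[K] MvPolynomial σ K).toRingHom.toAlgebra
  have : IsScalarTower K (MvPolynomial ι K) (MvPolynomial σ K) :=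
    .of_algebraMap_eq fun r => ((aeval g).commutes r).symm
  have hX (i : ι) : algebraMap (MvPolynomial ι K) (MvPolynomial σ K) (X i) = g i := aeval_X g i
  have : Module.Finite (MvPolynomial ι K) (MvPolynomial σ K) :=
    moduleFinite_of_idealOfVars_pow_le (R := K) (a := X) he (by simpa only [hX] using hge)
      (by simpa only [hX] using hd)
  exact fun x => Algebra.IsIntegral.isIntegral x

lemma injective [Finite ι] (hg : IsHomogeneousParameters g) :
    Function.Injective (aeval g : MvPolynomial ι K →ₐ[K] MvPolynomial σ K) :=
  injective_of_isIntegral hg.card_eq.le hg.isIntegral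

variable {s : Finset ι} {I : Ideal (MvPolynomial σ K)}

lemma card_le_height [Finite ι] (hg : IsHomogeneousParameters g) (hs : ∀ i ∈ s, g i ∈ I) :
    s.card ≤ I.height := by
  let _ : Algebra (MvPolynomial ι K) (MvPolynomial σ K) :=
    (aeval g : MvPolynomial ι K →ₐ[K] MvPolynomial σ K).toRingHom.toAlgebra
  have : Algebra.IsIntegral (MvPolynomial ι K) (MvPolynomial σ K) := ⟨hg.isIntegral⟩
  have : FaithfulSMul (MvPolynomial ι K) (MvPolynomial σ K) :=
    (faithfulSMul_iff_algebraMap_injective _ _).2 hg.injective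
  rw [Ideal.height_eq_inf_minimalPrimes]
  refine le_iInf₂ fun Q hQ => ?_
  have := hQ.1.1
  have hle : coordIdeal K s ≤ Q.comap (algebraMap (MvPolynomial ι K) (MvPolynomial σ K)) := by
    rw [coordIdeal_eq_span, Ideal.span_le]
    rintro _ ⟨i, hi, rfl⟩
    refine hQ.1.2 ?_
    change aeval g (X i) ∈ I
    rw [aeval_X]
    exact hs i hi
  rw [← height_coordIdeal (K := K)]
  exact (Ideal.height_mono hle).trans (height_comap_le_of_hasGoingDown Q)

lemma height_eq [Finite ι] (hg : IsHomogeneousParameters g) (hs : ∀ i ∈ s, g i ∈ I)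
    (hI : ∀ v : ι → K, (∀ i ∈ s, v i = 0) → ∃ z ∈ zeroLocus K I, ∀ i, eval z (g i) = v i) :
    I.height = s.card := by
  refine le_antisymm ?_ (hg.card_le_height hs)
  let _ : Algebra (MvPolynomial ι K) (MvPolynomial σ K) :=
    (aeval g : MvPolynomial ι K →ₐ[K] MvPolynomial σ K).toRingHom.toAlgebra
  have : Algebra.IsIntegral (MvPolynomial ι K) (MvPolynomial σ K) := ⟨hg.isIntegral⟩
  obtain ⟨Q, hQI, hQ, hQs⟩ := Ideal.exists_ideal_over_prime_of_isIntegral (coordIdeal K s) I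
    fun h hh => killVars_eq_zero_of_aeval_mem hI (le_vanishingIdeal_zeroLocus I hh)
  calc I.height ≤ Q.height := Ideal.height_mono hQI
    _ ≤ (coordIdeal K s).height :=
        hQs ▸ height_le_height_comap_of_isIntegral (R := MvPolynomial ι K) Q
    _ = s.card := height_coordIdeal s

lemma ringKrullDim_eq [Finite ι] (hg : IsHomogeneousParameters g) (hs : ∀ i ∈ s, g i ∈ I)
    (hI : ∀ v : ι → K, (∀ i ∈ s, v i = 0) → ∃ z ∈ zeroLocus K I, ∀ i, eval z (g i) = v i) :
    ringKrullDim (MvPolynomial σ K ⧸ vanishingIdeal K (zeroLocus K I)) =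
      (Nat.card ι - s.card : ℕ) := by
  let S := MvPolynomial σ K ⧸ vanishingIdeal K (zeroLocus K I)
  let mk : MvPolynomial σ K →ₐ[K] S := Ideal.Quotient.mkₐ K _
  let ψ : MvPolynomial {i // i ∉ s} K →ₐ[K] S := aeval fun i => mk (g i)
  have hψ : ψ.comp (killVars K s) = mk.comp (aeval g) := by
    ext i
    simp only [AlgHom.comp_apply, aeval_X]
    by_cases hi : i ∈ s
    · rw [killVars_X_of_mem hi, map_zero, eq_comm]
      exact Ideal.Quotient.eq_zero_iff_mem.2 (le_vanishingIdeal_zeroLocus I (hs i hi))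
    · rw [killVars_X_of_notMem hi, aeval_X]
  have hψint : ψ.toRingHom.IsIntegral := by
    apply RingHom.IsIntegral.tower_top (killVars K s).toRingHom
    rw [show ψ.toRingHom.comp (killVars K s).toRingHom = mk.toRingHom.comp (aeval g).toRingHom from
      congrArg AlgHom.toRingHom hψ]
    exact hg.isIntegral.trans _ _ (RingHom.isIntegral_of_surjective _ Ideal.Quotient.mk_surjective)
  have hψinj : Function.Injective ψ := by
    refine (injective_iff_map_eq_zero ψ).2 fun h hh => ?_
    rw [← killVars_rename_val s h] at hh ⊢
    refine killVars_eq_zero_of_aeval_mem hI (Ideal.Quotient.eq_zero_iff_mem.1 ?_)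
    exact (DFunLike.congr_fun hψ _).symm.trans hh
  let _ : Algebra (MvPolynomial {i // i ∉ s} K) S := ψ.toRingHom.toAlgebra
  have : Algebra.IsIntegral (MvPolynomial {i // i ∉ s} K) S := ⟨hψint⟩
  have hcard : Nat.card {i // i ∉ s} = Nat.card ι - s.card := by
    have := Fintype.ofFinite ι
    classical
    simp [Nat.card_eq_fintype_card, Fintype.card_subtype_compl]
  rw [ringKrullDim_eq_of_isIntegral_of_injective (R := MvPolynomial {i // i ∉ s} K) (S := S) hψinj,
    MvPolynomial.ringKrullDim_of_isNoetherianRing, ringKrullDim_eq_zero_of_field, zero_add, hcard]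

end IsHomogeneousParameters

end HomogeneousParameters

section Cone

attribute [local instance] MvPolynomial.gradedAlgebra

variable {σ K : Type*} [Field K]

lemma eval_smul_of_isHomogeneous {R : Type*} [CommSemiring R] {f : MvPolynomial σ R} {n : ℕ}
    (hf : f.IsHomogeneous n) (τ : R) (z : σ → R) : eval (τ • z) f = τ ^ n * eval z f := by
  simp only [eval_eq, Finset.mul_sum]
  refine Finset.sum_congr rfl fun μ hμ => ?_
  have hdeg : ∑ i ∈ μ.support, μ i = n := by
    rw [← Finsupp.degree_apply, Finsupp.degree_eq_weight_one]
    exact hf (mem_support_iff.1 hμ)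
  simp only [Pi.smul_apply, smul_eq_mul, mul_pow, Finset.prod_mul_distrib,
    Finset.prod_pow_eq_pow_sum, hdeg]
  ring

lemma smul_mem_zeroLocus {I : Ideal (MvPolynomial σ K)}
    (hI : I.IsHomogeneous (homogeneousSubmodule σ K)) {z : σ → K} (hz : z ∈ zeroLocus K I)
    (τ : K) : τ • z ∈ zeroLocus K I := by
  intro f hf
  change eval (τ • z) f = 0
  rw [← sum_homogeneousComponent f, map_sum]
  refine Finset.sum_eq_zero fun n _ => ?_
  rw [eval_smul_of_isHomogeneous (homogeneousComponent_isHomogeneous n f)]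
  exact mul_eq_zero_of_right _ (hz _ (homogeneousComponent_mem_of_mem hI hf n))

lemma cone_projZeros {k : ℕ} {I : Ideal (MvPolynomial (Fin k) ℂ)}
    (hI : I.IsHomogeneous (homogeneousSubmodule (Fin k) ℂ)) {z₀ : Fin k → ℂ} (hz₀ : z₀ ≠ 0)
    (hz₀I : z₀ ∈ zeroLocus ℂ I) :
    {v : Fin k → ℂ | ∃ p ∈ projZeros I, v ∈ p.submodule} = zeroLocus ℂ I := by
  have hmk (z : Fin k → ℂ) (hz : z ≠ 0) (hzI : z ∈ zeroLocus ℂ I) :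
      Projectivization.mk ℂ z hz ∈ projZeros I := by
    obtain ⟨τ, hτ⟩ := Projectivization.exists_smul_eq_mk_rep ℂ z hz
    rw [Units.smul_def] at hτ
    change (Projectivization.mk ℂ z hz).rep ∈ zeroLocus ℂ I
    exact hτ ▸ smul_mem_zeroLocus hI hzI _
  ext z
  constructor
  · rintro ⟨p, hp, hz⟩
    rw [Projectivization.submodule_eq, Submodule.mem_span_singleton] at hz
    obtain ⟨τ, rfl⟩ := hz
    exact smul_mem_zeroLocus hI hp τ
  · intro hz
    by_cases hz0 : z = 0
    · exact ⟨_, hmk z₀ hz₀ hz₀I, hz0 ▸ Submodule.zero_mem _⟩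
    · refine ⟨_, hmk z hz0 hz, ?_⟩
      rw [Projectivization.submodule_mk]
      exact Submodule.mem_span_singleton_self z

lemma exists_isHomogeneous_of_mem_sup {I J : Ideal (MvPolynomial σ K)}
    (hI : I.IsHomogeneous (homogeneousSubmodule σ K))
    (hJ : J.IsHomogeneous (homogeneousSubmodule σ K)) {f : MvPolynomial σ K} {n : ℕ}
    (hf : f.IsHomogeneous n) (hmem : f ∈ I ⊔ J) :
    ∃ g ∈ I, g.IsHomogeneous n ∧ f - g ∈ J := by
  obtain ⟨g, hg, h, hh, rfl⟩ := Submodule.mem_sup.1 hmem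
  refine ⟨homogeneousComponent n g, homogeneousComponent_mem_of_mem hI hg n,
    homogeneousComponent_isHomogeneous n g, ?_⟩
  nth_rw 1 [← homogeneousComponent_eq_self hf]
  rw [map_add, add_sub_cancel_left]
  exact homogeneousComponent_mem_of_mem hJ hh n

variable [IsAlgClosed K] [Finite σ] {I : Ideal (MvPolynomial σ K)} {s : Finset σ}

lemma exists_isHomogeneousParameters (hI : I.IsHomogeneous (homogeneousSubmodule σ K))
    (h : ∀ z ∈ zeroLocus K I, (∀ i ∉ s, z i = 0) → z = 0) :
    ∃ g : σ → MvPolynomial σ K, IsHomogeneousParameters g ∧ (∀ i ∈ s, g i ∈ I) ∧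
      ∀ i ∉ s, g i = X i := by
  classical
  let J : Ideal (MvPolynomial σ K) := Ideal.span (X '' {i | i ∉ s})
  have hJ : J.IsHomogeneous (homogeneousSubmodule σ K) := by
    apply Ideal.homogeneous_span
    rintro _ ⟨i, -, rfl⟩
    exact ⟨1, isHomogeneous_X K i⟩
  obtain ⟨d, hd⟩ := exists_pow_idealOfVars_le (I := I ⊔ J) fun z hz =>
    h z (fun f hf => hz f (Ideal.mem_sup_left hf)) fun i hi => by
      simpa using hz (X i) (Ideal.mem_sup_right (Ideal.subset_span ⟨i, hi, rfl⟩))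
  have hpow (i : σ) : (X i : MvPolynomial σ K) ^ (d + 1) ∈ I ⊔ J :=
    hd (Ideal.pow_le_pow_right d.le_succ
      (Ideal.pow_mem_pow (Ideal.subset_span (Set.mem_range_self i)) _))
  have hXpow (i : σ) : ((X i : MvPolynomial σ K) ^ (d + 1)).IsHomogeneous (d + 1) := by
    simpa using (isHomogeneous_X K i).pow (d + 1)
  choose f hfI hf hfJ using fun i => exists_isHomogeneous_of_mem_sup hI hJ (hXpow i) (hpow i)
  refine ⟨fun i => if i ∈ s then f i else X i, ⟨rfl, fun i => ?_, fun z hz => ?_⟩,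
    fun i hi => by simpa only [if_pos hi] using hfI i, fun i hi => if_neg hi⟩
  · split_ifs
    exacts [⟨d + 1, d.succ_pos, hf i⟩, ⟨1, one_pos, isHomogeneous_X K i⟩]
  · have hzs : ∀ i ∉ s, z i = 0 := fun i hi => by simpa [hi] using hz i
    have hzJ : J ≤ RingHom.ker (eval z) := by
      rw [Ideal.span_le]
      rintro _ ⟨i, hi, rfl⟩
      exact (eval_X i).trans (hzs i hi)
    ext i
    by_cases hi : i ∈ s
    · have hfi : eval z (f i) = 0 := by simpa [hi] using hz i
      have hzi : eval z (X i ^ (d + 1) - f i) = 0 := hzJ (hfJ i)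
      rw [map_sub, hfi, sub_zero, map_pow, eval_X] at hzi
      exact eq_zero_of_pow_eq_zero hzi
    · exact hzs i hi

lemma exists_isHomogeneousParameters_of_surjOn
    (hI : I.IsHomogeneous (homogeneousSubmodule σ K))
    (h₀ : ∀ z ∈ zeroLocus K I, (∀ i ∉ s, z i = 0) → z = 0)
    (h₁ : ∀ w : σ → K, ∃ z ∈ zeroLocus K I, ∀ i ∉ s, z i = w i) :
    ∃ g : σ → MvPolynomial σ K, IsHomogeneousParameters g ∧ (∀ i ∈ s, g i ∈ I) ∧
      ∀ v : σ → K, (∀ i ∈ s, v i = 0) → ∃ z ∈ zeroLocus K I, ∀ i, eval z (g i) = v i := by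
  obtain ⟨g, hg, hgI, hgX⟩ := exists_isHomogeneousParameters hI h₀
  refine ⟨g, hg, hgI, fun v hv => ?_⟩
  obtain ⟨z, hz, hzv⟩ := h₁ v
  refine ⟨z, hz, fun i => ?_⟩
  by_cases hi : i ∈ s
  · rw [hv i hi]
    exact hz _ (hgI i hi)
  · rw [hgX i hi, eval_X, hzv i hi]

theorem height_eq_card_of_cone (hI : I.IsHomogeneous (homogeneousSubmodule σ K))
    (h₀ : ∀ z ∈ zeroLocus K I, (∀ i ∉ s, z i = 0) → z = 0)
    (h₁ : ∀ w : σ → K, ∃ z ∈ zeroLocus K I, ∀ i ∉ s, z i = w i) : I.height = s.card := by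
  obtain ⟨g, hg, hgI, hsurj⟩ := exists_isHomogeneousParameters_of_surjOn hI h₀ h₁
  exact hg.height_eq hgI hsurj

theorem ringKrullDim_eq_of_cone (hI : I.IsHomogeneous (homogeneousSubmodule σ K))
    (h₀ : ∀ z ∈ zeroLocus K I, (∀ i ∉ s, z i = 0) → z = 0)
    (h₁ : ∀ w : σ → K, ∃ z ∈ zeroLocus K I, ∀ i ∉ s, z i = w i) :
    ringKrullDim (MvPolynomial σ K ⧸ vanishingIdeal K (zeroLocus K I)) =
      (Nat.card σ - s.card : ℕ) := by
  obtain ⟨g, hg, hgI, hsurj⟩ := exists_isHomogeneousParameters_of_surjOn hI h₀ h₁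
  exact hg.ringKrullDim_eq hgI hsurj

end Cone

section LinearSections

attribute [local instance] MvPolynomial.gradedAlgebra

variable {m n k p : ℕ} {a : LinCoeff m n k}

lemma isHomogeneous_linMatrix (a : LinCoeff m n k) (i : Fin m) (j : Fin n) :
    (linMatrix a i j).IsHomogeneous 1 := by
  rw [linMatrix, Matrix.of_apply]
  exact IsHomogeneous.sum _ _ _ fun _ _ => isHomogeneous_C_mul_X _ _

lemma isHomogeneous_minorsIdeal (a : LinCoeff m n k) (r : ℕ) :
    (minorsIdeal (linMatrix a) r).IsHomogeneous (homogeneousSubmodule (Fin k) ℂ) := by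
  apply Ideal.homogeneous_span
  rintro _ ⟨f, g, rfl⟩
  exact ⟨_, isHomogeneous_det fun i j => isHomogeneous_linMatrix a (f i) (g j)⟩

lemma mem_zeroLocus_minorsIdeal_linMatrix {z : Fin k → ℂ} :
    z ∈ zeroLocus ℂ (minorsIdeal (linMatrix a) m) ↔ ∃ v ≠ 0, v ᵥ* evalMatrix a z = 0 := by
  rw [mem_zeroLocus_minorsIdeal, map_eval_linMatrix]

lemma exists_map_mem_zeroLocus_minorsIdeal (hm : 0 < m) (hp : 0 < p) (hn : n + 2 ≤ m + p)
    (a : LinCoeff m n k) (L : (Fin p → ℂ) →ₗ[ℂ] (Fin k → ℂ)) :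
    ∃ u ≠ 0, L u ∈ zeroLocus ℂ (minorsIdeal (linMatrix a) m) := by
  let a' : LinCoeff m n p := fun q => ∑ i, a (q.1, q.2.1, i) * L.toMatrix' i q.2.2
  have ha' (u : Fin p → ℂ) : evalMatrix a' u = evalMatrix a (L u) := by
    ext i j
    simp only [← L.toMatrix'_mulVec, evalMatrix, Matrix.of_apply, a', Matrix.mulVec, dotProduct,
      Finset.sum_mul, Finset.mul_sum, mul_assoc]
    exact Finset.sum_comm
  obtain ⟨u, hu, hv⟩ := not_fullRank_iff.1 (not_fullRank hm hp hn a')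
  exact ⟨u, hu, mem_zeroLocus_minorsIdeal_linMatrix.2 (ha' u ▸ hv)⟩

/-- The coefficients of the restriction to the subspace of the first `p` coordinates. -/
def firstCoeff (h : p ≤ k) (a : LinCoeff m n k) : LinCoeff m n p :=
  fun q => a (q.1, q.2.1, Fin.castLE h q.2.2)

lemma generic_fullRank_firstCoeff (h : p ≤ k) (hmp : m + p ≤ n + 1) :
    Generic fun a : LinCoeff m n k => FullRank (firstCoeff h a) := by
  refine (generic_fullRank hmp).comp
    (e := fun q : Fin m × Fin n × Fin p => (q.1, q.2.1, Fin.castLE h q.2.2)) ?_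
  rintro ⟨i, j, l⟩ ⟨i', j', l'⟩ heq
  simpa using heq

lemma evalMatrix_firstCoeff (h : p ≤ k) (a : LinCoeff m n k) {z : Fin k → ℂ}
    (hz : ∀ i : Fin k, p ≤ i → z i = 0) :
    evalMatrix (firstCoeff h a) (fun i => z (Fin.castLE h i)) = evalMatrix a z := by
  ext i j
  simp only [evalMatrix, firstCoeff, Matrix.of_apply]
  refine Finset.sum_of_injOn (Fin.castLE h) (Fin.castLE_injective h).injOn
    (fun _ _ => Finset.mem_coe.2 (Finset.mem_univ _)) ?_ fun _ _ => rfl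
  intro l _ hl
  have hpl : p ≤ l := by
    by_contra! hlt
    exact hl ⟨⟨l, hlt⟩, by simp, rfl⟩
  rw [hz l hpl, mul_zero]

variable {h : p ≤ k}

lemma FullRank.eq_zero_of_firstCoeff (ha : FullRank (firstCoeff h a)) {z : Fin k → ℂ}
    (hz : ∀ i : Fin k, p ≤ i → z i = 0) (hzI : z ∈ zeroLocus ℂ (minorsIdeal (linMatrix a) m)) :
    z = 0 := by
  obtain ⟨v, hv, hvz⟩ := mem_zeroLocus_minorsIdeal_linMatrix.1 hzI
  rw [← evalMatrix_firstCoeff h a hz] at hvz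
  by_contra hz0
  refine hv (ha _ (fun hfirst => hz0 (_root_.funext fun i => ?_)) v hvz)
  by_cases hi : p ≤ i
  · exact hz i hi
  · exact congrFun hfirst ⟨i, not_le.1 hi⟩

/-- The span of `w` and the first `p` coordinate vectors meets the zero locus outside the origin,
and the point found there is not in the span of the latter. -/
lemma FullRank.exists_mem_zeroLocus_of_firstCoeff (ha : FullRank (firstCoeff h a)) (hm : 0 < m)
    (hn : n + 1 ≤ m + p) (w : Fin k → ℂ) :
    ∃ z ∈ zeroLocus ℂ (minorsIdeal (linMatrix a) m), ∀ i : Fin k, p ≤ i → z i = w i := by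
  let L : (Fin (p + 1) → ℂ) →ₗ[ℂ] (Fin k → ℂ) := LinearMap.pi fun i =>
    if hi : (i : ℕ) < p then LinearMap.proj (Fin.castSucc ⟨i, hi⟩)
    else w i • LinearMap.proj (Fin.last p)
  have hLlt (u : Fin (p + 1) → ℂ) (i : Fin p) : L u (Fin.castLE h i) = u i.castSucc := by
    simp only [L, LinearMap.pi_apply, Fin.val_castLE, i.isLt, dif_pos, LinearMap.proj_apply]
  have hLge (u : Fin (p + 1) → ℂ) (i : Fin k) (hi : p ≤ i) : L u i = w i * u (Fin.last p) := by
    simp [L, hi.not_gt]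
  obtain ⟨u, hu, huI⟩ := exists_map_mem_zeroLocus_minorsIdeal hm p.succ_pos (by omega) a L
  have hlast : u (Fin.last p) ≠ 0 := by
    intro hu0
    have hLu := ha.eq_zero_of_firstCoeff (fun i hi => by rw [hLge u i hi, hu0, mul_zero]) huI
    refine hu (_root_.funext (Fin.lastCases hu0 fun i => ?_))
    rw [← hLlt u i, hLu, Pi.zero_apply, Pi.zero_apply]
  refine ⟨(u (Fin.last p))⁻¹ • L u, smul_mem_zeroLocus (isHomogeneous_minorsIdeal a m) huI _,
    fun i hi => ?_⟩
  rw [Pi.smul_apply, hLge u i hi, smul_eq_mul, mul_comm (w i), inv_mul_cancel_left₀ hlast]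

/-- The first `p` of `k` indices. -/
def firstIndices (k p : ℕ) : Finset (Fin k) := Finset.univ.filter fun i => (i : ℕ) < p

lemma notMem_firstIndices {i : Fin k} : i ∉ firstIndices k p ↔ p ≤ i := by
  simp [firstIndices]

lemma card_firstIndices (h : p ≤ k) : (firstIndices k p).card = p := by
  rw [firstIndices, Fin.card_filter_val_lt, min_eq_right h]

theorem FullRank.height_minorsIdeal (ha : FullRank (firstCoeff h a)) (hm : 0 < m)
    (hn : n + 1 ≤ m + p) : (minorsIdeal (linMatrix a) m).height = p := by
  rw [height_eq_card_of_cone (isHomogeneous_minorsIdeal a m) (s := firstIndices k p),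
    card_firstIndices h]
  · simpa only [notMem_firstIndices] using fun z hzI hz => ha.eq_zero_of_firstCoeff hz hzI
  · simpa only [notMem_firstIndices] using ha.exists_mem_zeroLocus_of_firstCoeff hm hn

theorem FullRank.ringKrullDim_minorsIdeal (ha : FullRank (firstCoeff h a)) (hm : 0 < m)
    (hn : n + 1 ≤ m + p) :
    ringKrullDim (MvPolynomial (Fin k) ℂ ⧸
      vanishingIdeal ℂ (zeroLocus ℂ (minorsIdeal (linMatrix a) m))) = (k - p : ℕ) := by
  rw [ringKrullDim_eq_of_cone (isHomogeneous_minorsIdeal a m) (s := firstIndices k p),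
    card_firstIndices h, Nat.card_eq_fintype_card, Fintype.card_fin]
  · simpa only [notMem_firstIndices] using fun z hzI hz => ha.eq_zero_of_firstCoeff hz hzI
  · simpa only [notMem_firstIndices] using ha.exists_mem_zeroLocus_of_firstCoeff hm hn

theorem FullRank.isDeterminantal (ha : FullRank (firstCoeff h a)) (hm : 0 < m) (hmn : m ≤ n)
    (hn : n + 1 = m + p) : IsDeterminantal (linMatrix a) m := by
  refine ⟨hm, le_rfl, hmn, ?_⟩
  rw [ha.height_minorsIdeal hm hn.le, Nat.sub_self, zero_add, one_mul]
  congr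
  omega

theorem FullRank.hasProjDim (ha : FullRank (firstCoeff h a)) (hm : 0 < m) (hn : n + 1 ≤ m + p)
    (hp : p < k) : HasProjDim (projZeros (minorsIdeal (linMatrix a) m)) (k - p - 1) := by
  obtain ⟨z, hzI, hz⟩ := ha.exists_mem_zeroLocus_of_firstCoeff hm hn 1
  have hz0 : z ≠ 0 := by
    rintro rfl
    exact zero_ne_one (hz ⟨p, hp⟩ le_rfl)
  rw [HasProjDim, cone_projZeros (isHomogeneous_minorsIdeal a m) hz0 hzI,
    ha.ringKrullDim_minorsIdeal hm hn, Nat.sub_add_cancel (Nat.sub_pos_of_lt hp)]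

theorem generic_isDeterminantal_and_hasProjDim {t N : ℕ} (htN : t + 1 ≤ N) (hN : N < 2 * t) :
    Generic fun a : LinCoeff (t + 1) N t => IsDeterminantal (linMatrix a) (t + 1) ∧
      HasProjDim (projZeros (minorsIdeal (linMatrix a) (t + 1))) (2 * t - N - 1) := by
  refine (generic_fullRank_firstCoeff (p := N - t) (by omega) (by omega)).mono fun a ha =>
    ⟨ha.isDeterminantal t.succ_pos htN (by omega), ?_⟩
  convert ha.hasProjDim t.succ_pos (by omega) (by omega) using 2
  omega

end LinearSections

section MaxRank

variable {m n k : ℕ}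

lemma generic_det_ne_zero (r : ℕ) :
    Generic fun c : Fin r × Fin r → ℂ => (Matrix.of fun i j => c (i, j)).det ≠ 0 := by
  refine ⟨(Matrix.mvPolynomialX (Fin r) (Fin r) ℂ).det, Matrix.det_mvPolynomialX_ne_zero _ _,
    fun c hc => ?_⟩
  rw [RingHom.map_det] at hc
  convert hc
  ext i j
  simp

/-- The matrix of linear forms with coefficients `a` has the maximal rank at each of the basis
vectors of the space of variables. -/
def MaxRankAtBasis (a : LinCoeff m n k) : Prop :=
  ∀ i, min m n ≤ (evalMatrix a (Pi.single i 1)).rank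

lemma evalMatrix_single (a : LinCoeff m n k) (l : Fin k) :
    evalMatrix a (Pi.single l 1) = Matrix.of fun i j => a (i, j, l) := by
  ext i j
  simp [evalMatrix, Pi.single_apply]

lemma generic_maxRankAtBasis : Generic fun a : LinCoeff m n k => MaxRankAtBasis a := by
  refine Generic.forall_finite fun l => ?_
  let f : Fin (min m n) → Fin m := Fin.castLE (min_le_left m n)
  let g : Fin (min m n) → Fin n := Fin.castLE (min_le_right m n)
  have he : Function.Injective fun p : Fin (min m n) × Fin (min m n) => (f p.1, g p.2, l) := by
    rintro ⟨i, j⟩ ⟨i', j'⟩ h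
    simpa [f, g] using h
  refine ((generic_det_ne_zero (min m n)).comp he).mono fun a ha => ?_
  rw [evalMatrix_single]
  exact le_rank_of_submatrix_det_ne_zero _ f g ha

lemma exists_rank_evalMatrix_lt (hm : 0 < m) (hk : 0 < k) (hn : n + 2 ≤ m + k)
    (a : LinCoeff m n k) : ∃ s ≠ 0, (evalMatrix a s).rank < m := by
  obtain ⟨s, hs, hv⟩ := not_fullRank_iff.1 (not_fullRank hm hk hn a)
  exact ⟨s, hs, by simpa only [Fintype.card_fin] using (rank_lt_card_iff_exists_vecMul _).2 hv⟩

lemma exists_rank_evalMatrix_lt_min (hm : 0 < m) (hn : 0 < n) (hk : 0 < k)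
    (hnm : n + 2 ≤ m + k) (hmn : m + 2 ≤ n + k) (a : LinCoeff m n k) :
    ∃ s ≠ 0, (evalMatrix a s).rank < min m n := by
  rcases le_total m n with h | h
  · rw [min_eq_left h]
    exact exists_rank_evalMatrix_lt hm hk hnm a
  · obtain ⟨s, hs, hlt⟩ :=
      exists_rank_evalMatrix_lt hn hk hmn fun p : Fin n × Fin m × Fin k => a (p.2.1, p.1, p.2.2)
    refine ⟨s, hs, ?_⟩
    rw [min_eq_right h, ← Matrix.rank_transpose]
    exact hlt

end MaxRank

section Tjurina

variable {t N : ℕ} {c : LinCoeff t (t + 1) N}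

/-- Over the origin the Jacobian matrix at `(0, s)` reduces to `A(s)`, so a smooth point has the
greatest rank on the whole chart. -/
lemma zero_mem_tjurinaSing {p : ℙ ℂ (Fin t → ℂ)}
    (h : ∀ i, (evalMatrix (derivCoeff c) p.rep).rank <
      (evalMatrix (derivCoeff c) (Pi.single i 1)).rank) :
    ((0, p) : (Fin N → ℂ) × ℙ ℂ (Fin t → ℂ)) ∈ tjurinaSing (linMatrix c) := by
  obtain ⟨i, hi⟩ := Function.ne_iff.1 p.rep_nonzero
  have hchart : ((p.rep i)⁻¹ • p.rep) i = 1 := inv_mul_cancel₀ hi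
  refine ⟨i, hi, (mem_zeroLocus_tjurinaIdeal_iff c).2 ⟨hchart, ?_⟩, fun hsmooth => ?_⟩
  · rw [evalMatrix_zero, Matrix.vecMul_zero]
  · have hle := rank_le_of_isSmoothPoint_tjurinaIdeal c hchart (Pi.single_eq_same i 1) hsmooth
    rw [rank_evalMatrix_smul _ (inv_ne_zero hi)] at hle
    exact (h i).not_ge hle

lemma IsICMC2.of_mem_tjurinaSing (hc : IsICMC2 c) {y : (Fin N → ℂ) × ℙ ℂ (Fin t → ℂ)}
    (hy : y ∈ tjurinaSing (linMatrix c)) :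
    y.1 = 0 ∧ ∃ v ≠ 0, v ᵥ* evalMatrix (derivCoeff c) y.2.rep = 0 := by
  obtain ⟨i, hi, hmem, hsing⟩ := hy
  obtain ⟨hs, hxs⟩ := (mem_zeroLocus_tjurinaIdeal_iff c).1 hmem
  have hs₀ : (y.2.rep i)⁻¹ • y.2.rep ≠ 0 := smul_ne_zero (inv_ne_zero hi) y.2.rep_nonzero
  have hJacobian : ¬ ∀ v, v ᵥ* evalMatrix (derivCoeff c) ((y.2.rep i)⁻¹ • y.2.rep) = 0 →
      evalMatrix c y.1 *ᵥ v = 0 → v = 0 :=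
    fun h => hsing (isSmoothPoint_tjurinaIdeal c hs hxs h)
  push Not at hJacobian
  obtain ⟨v, hvA, hvM, hv⟩ := hJacobian
  refine ⟨?_, v, hv, ?_⟩
  · by_contra hx
    exact hv (hc.eq_zero_of_vecMul_of_mulVec hx hs₀ hxs hvA hvM)
  · rw [evalMatrix_smul, Matrix.vecMul_smul] at hvA
    exact (smul_eq_zero_iff_right (inv_ne_zero hi)).1 hvA

lemma MaxRankAtBasis.mk_mem_tjurinaSing (hr : MaxRankAtBasis (derivCoeff c)) {s : Fin t → ℂ}
    (hs : s ≠ 0) (hlt : (evalMatrix (derivCoeff c) s).rank < min (t + 1) N) :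
    (0, Projectivization.mk ℂ s hs) ∈ tjurinaSing (linMatrix c) := by
  obtain ⟨τ, hτ⟩ := Projectivization.exists_smul_eq_mk_rep ℂ s hs
  refine zero_mem_tjurinaSing fun i => ?_
  rw [← hτ, Units.smul_def, rank_evalMatrix_smul _ τ.ne_zero]
  exact hlt.trans_le (hr i)

theorem MaxRankAtBasis.not_tjurinaSmooth (hr : MaxRankAtBasis (derivCoeff c)) (h₁ : 3 ≤ N)
    (h₂ : N < 2 * t) : ¬ TjurinaSmooth (linMatrix c) := by
  obtain ⟨s, hs, hlt⟩ := exists_rank_evalMatrix_lt_min t.succ_pos (by omega) (by omega)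
    (by omega) (by omega) (derivCoeff c)
  exact Set.nonempty_iff_ne_empty.1 ⟨_, hr.mk_mem_tjurinaSing hs hlt⟩

theorem IsICMC2.tjurinaSmooth (hc : IsICMC2 c) (h : FullRank (derivCoeff c)) :
    TjurinaSmooth (linMatrix c) := by
  refine Set.eq_empty_of_forall_notMem fun y hy => ?_
  obtain ⟨-, v, hv, hvs⟩ := hc.of_mem_tjurinaSing hy
  exact hv (h _ y.2.rep_nonzero v hvs)

lemma IsICMC2.two_le (hc : IsICMC2 c) : 2 ≤ N := by
  obtain ⟨⟨-, -, -, hcodim⟩, -⟩ := hc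
  have hheight : (minorsIdeal (linMatrix c) t).height = 2 := by
    rw [hcodim, Nat.sub_self, Nat.add_sub_cancel_left]
    rfl
  have hproper : minorsIdeal (linMatrix c) t ≠ ⊤ := by
    intro htop
    rw [htop, Ideal.height_top] at hheight
    exact ENat.top_ne_ofNat 2 hheight
  have hle := Ideal.height_le_ringKrullDim_of_ne_top hproper
  rw [hheight, MvPolynomial.ringKrullDim_of_isNoetherianRing, ringKrullDim_eq_zero_of_field,
    zero_add, Nat.card_eq_fintype_card, Fintype.card_fin] at hle
  exact_mod_cast hle

lemma IsICMC2.tjurinaSmooth_iff (hc : IsICMC2 c) (hr : MaxRankAtBasis (derivCoeff c))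
    (hN : N < 2 * t) (h : 3 ≤ N ∨ t = 1) : TjurinaSmooth (linMatrix c) ↔ 2 * t ≤ N := by
  rcases h with h₃ | rfl
  · exact iff_of_false (hr.not_tjurinaSmooth h₃ hN) hN.not_ge
  · exact absurd hc.two_le hN.not_ge

theorem IsICMC2.tjurinaSing_eq (hc : IsICMC2 c) (hr : MaxRankAtBasis (derivCoeff c))
    (hN : t + 1 ≤ N) : tjurinaSing (linMatrix c) =
      {0} ×ˢ projZeros (minorsIdeal (linMatrix (derivCoeff c)) (t + 1)) := by
  ext ⟨x, p⟩
  constructor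
  · intro hy
    obtain ⟨hx, hp⟩ := hc.of_mem_tjurinaSing hy
    exact ⟨hx, mem_zeroLocus_minorsIdeal_linMatrix.2 hp⟩
  · rintro ⟨rfl, hp⟩
    have hlt := (rank_lt_card_iff_exists_vecMul _).2 (mem_zeroLocus_minorsIdeal_linMatrix.1 hp)
    rw [Fintype.card_fin] at hlt
    exact zero_mem_tjurinaSing fun i => hlt.trans_le ((le_min le_rfl hN).trans (hr i))

end Tjurina

end TjurinaTransform

end

open TjurinaTransform in
theorem mainTheorem4 (t N : ℕ) (ht : 1 ≤ t) :
    (Generic fun c : LinCoeff t (t + 1) N =>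
      IsICMC2 c →
        ((3 ≤ N ∨ t = 1) → (TjurinaSmooth (linMatrix c) ↔ 2 * t ≤ N)) ∧
        (t + 1 ≤ N → N < 2 * t →
          tjurinaSing (linMatrix c) =
            {0} ×ˢ projZeros (minorsIdeal (linMatrix (derivCoeff c)) (t + 1)) ∧
          IsDeterminantal (linMatrix (derivCoeff c)) (t + 1) ∧
          HasProjDim (projZeros (minorsIdeal (linMatrix (derivCoeff c)) (t + 1)))
            (2 * t - N - 1))) ∧
    (∀ Q : LinCoeff (t + 1) N t → Prop, Generic Q →
      Generic fun c : LinCoeff t (t + 1) N => Q (derivCoeff c)) := by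
  refine ⟨?_, fun Q hQ => hQ.derivCoeff⟩
  have hrank : Generic fun c : LinCoeff t (t + 1) N => MaxRankAtBasis (derivCoeff c) :=
    generic_maxRankAtBasis.derivCoeff
  rcases le_or_gt (2 * t) N with hN | hN
  · have hfull : Generic fun c : LinCoeff t (t + 1) N => FullRank (derivCoeff c) :=
      (generic_fullRank (by omega)).derivCoeff
    exact hfull.mono fun c hfull hc =>
      ⟨fun _ => iff_of_true (hc.tjurinaSmooth hfull) hN, fun _ h => absurd h hN.not_gt⟩
  · rcases le_or_gt (t + 1) N with htN | htN
    · exact (hrank.and (generic_isDeterminantal_and_hasProjDim htN hN).derivCoeff).mono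
        fun c ⟨hr, hdet⟩ hc =>
          ⟨hc.tjurinaSmooth_iff hr hN, fun _ _ => ⟨hc.tjurinaSing_eq hr htN, hdet⟩⟩
    · exact hrank.mono fun c hr hc =>
        ⟨hc.tjurinaSmooth_iff hr hN, fun h => absurd h htN.not_ge⟩
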